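/- Let $\beta=(\beta(j))_{j\ge 0}$ be a sequence of positive numbers with $\beta(0)=1$ and $\liminf_{j\to\infty}\beta(j)^{1/j}\ge 1$, and let $H^2(\beta)$ be the weighted Hardy space of the open unit disk $\mathbb{D}$: the Hilbert space of all functions $f(z)=\sum_j \hat f(j)z^j$ holomorphic on $\mathbb{D}$ with $\sum_{j}|\hat f(j)|^2\beta(j)^2<\infty$, with inner product $\langle f,g\rangle=\sum_{j}\hat f(j)\overline{\hat g(j)}\beta(j)^2$. Let $k(z)=\sum_{j=0}^\infty z^j/\beta(j)^2$, $z\in\mathbb{D}$, be its generating function. Let $\varphi$ be a holomorphic selfmap of $\mathbb{D}$ with $\varphi(0)\neq 0$ and $\varphi'(0)\ne 0$, let $\psi$ be a holomorphic function on $\mathbb{D}$ that is not the zero function, and let $W_{\psi,\varphi}f=\psi\cdot(f\circ\varphi)$. The following are equivalent. (i) $W_{\psi,\varphi}$ is a bounded Hermitian operator on $H^2(\beta)$. (ii) $W_{\psi,\varphi}$ is a bounded operator on $H^2(\beta)$ satisfying $W_{\psi,\varphi}^*1=W_{\psi,\varphi}1$, $W_{\psi,\varphi}^*z=W_{\psi,\varphi}z$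 and $W_{\psi,\varphi}^*z^2=W_{\psi,\varphi}z^2$. (iii) The generating function has one of the following forms on $\mathbb{D}$: $k(z)=e^{z/\beta(1)^2}$ in case $2\beta(1)^4/\beta(2)^2=1$, and otherwise $k(z)=(1-\lambda z)^{-1/(\lambda\beta(1)^2)}$ (principal branch), where $\lambda=\frac{1}{\beta(1)^2}\left(\frac{2\beta(1)^4}{\beta(2)^2}-1\right)$ satisfies $0<\lambda\le 1$. In addition, for all $z\in\mathbb{D}$, $$\psi(z)=c\,k(\overline{a_0}z)\quad\text{and}\quad \varphi(z)=a_0+a_1\beta(1)^2 z\,\frac{k'(\overline{a_0}z)}{k(\overline{a_0}z)},$$ where $a_0=\varphi(0)$, $a_1=\varphi'(0)$ is real, and $c=\psi(0)$ is real. -/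

import Mathlib

/-- A weight sequence: `β j > 0`, `β 0 = 1` and `liminf β(j)^{1/j} ≥ 1`. These are exactly the
sequences `β j = ‖z ^ j‖` that arise from weighted Hardy spaces of the unit disc, normalized by
`‖1‖ = 1`. The `liminf` is taken in `[0, ∞]`. -/
structure WeightSequence where
  /-- the underlying sequence -/
  toFun : ℕ → ℝ
  pos : ∀ j, 0 < toFun j
  map_zero : toFun 0 = 1
  one_le_liminf : 1 ≤ Filter.liminf
    (fun j : ℕ => ENNReal.ofReal (toFun j ^ (1 / (j : ℝ)))) Filter.atTop

namespace WeightSequence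

instance : CoeFun WeightSequence (fun _ => ℕ → ℝ) := ⟨WeightSequence.toFun⟩

theorem eventually_pow_le (β : WeightSequence) {r : ℝ} (hr0 : 0 < r) (hr : r < 1) :
    ∀ᶠ n in Filter.atTop, r ^ n ≤ β n := by
  have h1 : ENNReal.ofReal r < Filter.liminf
      (fun j : ℕ => ENNReal.ofReal (β j ^ (1 / (j : ℝ)))) Filter.atTop :=
    lt_of_lt_of_le (by simpa using hr) β.one_le_liminf
  filter_upwards [Filter.eventually_lt_of_lt_liminf h1, Filter.eventually_gt_atTop 0] with n hn hn0
  have h2 : r ≤ β n ^ (1 / (n : ℝ)) := by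
    by_contra hcon
    exact absurd hn (not_lt.2 (ENNReal.ofReal_le_ofReal (le_of_not_ge hcon)))
  calc r ^ n ≤ (β n ^ (1 / (n : ℝ))) ^ n := pow_le_pow_left₀ hr0.le h2 n
    _ = β n := by
      rw [one_div, Real.rpow_inv_natCast_pow (β.pos n).le hn0.ne']

/-- The generating function `k(z) = ∑ zʲ / β(j)²` of `H²(β)`. -/
noncomputable def generatingFunction (β : WeightSequence) (z : ℂ) : ℂ :=
  ∑' j : ℕ, z ^ j / (β j : ℂ) ^ 2

/-- The series that defines the generating function converges at every point of the disc. -/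
theorem hasSum_generatingFunction (β : WeightSequence) {z : ℂ} (hz : z ∈ Metric.ball (0 : ℂ) 1) :
    HasSum (fun j : ℕ => z ^ j / (β j : ℂ) ^ 2) (β.generatingFunction z) := by
  have hz1 : ‖z‖ < 1 := by simpa using hz
  obtain ⟨s, hs1, hs2⟩ := exists_between hz1
  have hs0 : 0 < s := (norm_nonneg z).trans_lt hs1
  have hr1 : √s < 1 := by rw [Real.sqrt_lt' one_pos]; simpa using hs2
  apply Summable.hasSum
  refine Summable.of_norm_bounded_eventually_nat (g := fun n => (‖z‖ / s) ^ n)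
    (summable_geometric_of_lt_one (by positivity) ((div_lt_one hs0).2 hs1)) ?_
  filter_upwards [β.eventually_pow_le (Real.sqrt_pos.2 hs0) hr1] with n hn
  have h2 : s ^ n ≤ β n ^ 2 := by
    calc s ^ n = (√s ^ n) ^ 2 := by rw [← pow_mul, mul_comm, pow_mul, Real.sq_sqrt hs0.le]
      _ ≤ β n ^ 2 := pow_le_pow_left₀ (by positivity) hn 2
  rw [norm_div, norm_pow, norm_pow, Complex.norm_real, Real.norm_eq_abs, sq_abs, div_pow]
  gcongr

end WeightSequence

/-- The `n`-th Maclaurin coefficient of `f`. -/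
noncomputable def maclaurinCoeff (f : ℂ → ℂ) (n : ℕ) : ℂ :=
  iteratedDeriv n f 0 / (n.factorial : ℂ)

theorem maclaurinCoeff_hasSum {f : ℂ → ℂ} (hf : DifferentiableOn ℂ f (Metric.ball 0 1))
    {z : ℂ} (hz : z ∈ Metric.ball (0 : ℂ) 1) :
    HasSum (fun n => maclaurinCoeff f n * z ^ n) (f z) := by
  have h := Complex.hasSum_taylorSeries_on_ball (r := 1) (c := 0) (f := f) (by simpa using hf)
    (by simpa using hz)
  refine h.congr_fun ?_ |> fun h => h
  intro n
  simp only [maclaurinCoeff, sub_zero, smul_eq_mul]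
  ring

theorem maclaurinCoeff_eq_of_hasSum {f : ℂ → ℂ} {a : ℕ → ℂ}
    (h : ∀ z ∈ Metric.ball (0 : ℂ) 1, HasSum (fun n => a n * z ^ n) (f z)) (n : ℕ) :
    maclaurinCoeff f n = a n := by
  have h1 : HasFPowerSeriesAt f (FormalMultilinearSeries.ofScalars ℂ a) 0 := by
    rw [hasFPowerSeriesAt_iff]
    filter_upwards [Metric.ball_mem_nhds (0 : ℂ) one_pos] with z hz
    simpa [FormalMultilinearSeries.coeff_ofScalars, mul_comm] using h z hz
  have h2 := h1.analyticAt.hasFPowerSeriesAt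
  have h3 := congrArg (fun p => FormalMultilinearSeries.coeff p n)
    (h2.eq_formalMultilinearSeries h1)
  simpa [FormalMultilinearSeries.coeff_ofScalars, maclaurinCoeff] using h3

theorem maclaurinCoeff_add {f g : ℂ → ℂ} (hf : DifferentiableOn ℂ f (Metric.ball 0 1))
    (hg : DifferentiableOn ℂ g (Metric.ball 0 1)) (n : ℕ) :
    maclaurinCoeff (f + g) n = maclaurinCoeff f n + maclaurinCoeff g n := by
  apply maclaurinCoeff_eq_of_hasSum
  intro z hz
  simpa [add_mul] using (maclaurinCoeff_hasSum hf hz).add (maclaurinCoeff_hasSum hg hz)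

theorem maclaurinCoeff_smul {f : ℂ → ℂ} (c : ℂ) (hf : DifferentiableOn ℂ f (Metric.ball 0 1))
    (n : ℕ) : maclaurinCoeff (c • f) n = c * maclaurinCoeff f n := by
  apply maclaurinCoeff_eq_of_hasSum
  intro z hz
  simpa [mul_assoc] using (maclaurinCoeff_hasSum hf hz).mul_left c

theorem maclaurinCoeff_zero (n : ℕ) : maclaurinCoeff 0 n = 0 := by
  apply maclaurinCoeff_eq_of_hasSum (a := fun _ => 0)
  intro z _
  simp

/-- Weighted square-summability is the same as the scaled coefficients lying in `ℓ²`. -/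
theorem weighted_summable_iff_memℓp (β : WeightSequence) (a : ℕ → ℂ) :
    Summable (fun n => ‖a n‖ ^ 2 * β n ^ 2) ↔ Memℓp (fun n => (β n : ℂ) * a n) 2 := by
  rw [memℓp_gen_iff (by norm_num)]
  refine summable_congr fun n => ?_
  simp [mul_pow, mul_comm]

/-- The underlying linear space of `H²(β)`: functions holomorphic on the unit disc whose
Maclaurin coefficients satisfy `∑ |f̂(n)|² β(n)² < ∞`. A function on the disc is represented by
its extension by zero to `ℂ`, so that equality of elements is equality on the disc. -/
def weightedHardySubmodule (β : WeightSequence) : Submodule ℂ (ℂ → ℂ) where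
  carrier := {f | DifferentiableOn ℂ f (Metric.ball 0 1) ∧
    (∀ z ∉ Metric.ball (0 : ℂ) 1, f z = 0) ∧
    Summable (fun n => ‖maclaurinCoeff f n‖ ^ 2 * β n ^ 2)}
  zero_mem' := ⟨differentiableOn_const 0, fun _ _ => rfl, by
    simp [maclaurinCoeff_zero]⟩
  add_mem' := by
    rintro f g ⟨hf, hf0, hfs⟩ ⟨hg, hg0, hgs⟩
    refine ⟨hf.add hg, fun z hz => by simp [hf0 z hz, hg0 z hz], ?_⟩
    rw [weighted_summable_iff_memℓp] at *
    convert hfs.add hgs using 1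
    funext n
    simp [maclaurinCoeff_add hf hg, mul_add]
  smul_mem' := by
    rintro c f ⟨hf, hf0, hfs⟩
    refine ⟨hf.const_smul c, fun z hz => by simp [hf0 z hz], ?_⟩
    rw [weighted_summable_iff_memℓp] at *
    convert hfs.const_smul c using 1
    funext n
    simp [maclaurinCoeff_smul c hf]
    ring

/-- The weighted Hardy space `H²(β)` of the unit disc. -/
def WeightedHardy (β : WeightSequence) : Type := weightedHardySubmodule β

namespace WeightedHardy

variable {β : WeightSequence}

noncomputable instance : AddCommGroup (WeightedHardy β) :=
  inferInstanceAs (AddCommGroup (weightedHardySubmodule β))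

noncomputable instance : Module ℂ (WeightedHardy β) :=
  inferInstanceAs (Module ℂ (weightedHardySubmodule β))

instance : CoeFun (WeightedHardy β) (fun _ => ℂ → ℂ) := ⟨fun f => f.1⟩

theorem differentiableOn (f : WeightedHardy β) : DifferentiableOn ℂ f (Metric.ball 0 1) := f.2.1

/-- The `n`-th Maclaurin coefficient of an element of `H²(β)`. -/
noncomputable def coeff (f : WeightedHardy β) (n : ℕ) : ℂ := maclaurinCoeff f n

theorem ext_coeff {f g : WeightedHardy β} (h : ∀ n, coeff f n = coeff g n) : f = g := by
  apply Subtype.ext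
  funext z
  by_cases hz : z ∈ Metric.ball (0 : ℂ) 1
  · have h1 := maclaurinCoeff_hasSum f.2.1 hz
    have h2 := maclaurinCoeff_hasSum g.2.1 hz
    have h3 : (fun n => maclaurinCoeff f.1 n * z ^ n) = fun n => maclaurinCoeff g.1 n * z ^ n := by
      funext n
      have := h n
      simp only [coeff] at this
      rw [this]
    rw [h3] at h1
    exact h1.unique h2
  · rw [f.2.2.1 z hz, g.2.2.1 z hz]

/-- The scaled coefficient map `f ↦ (β(n) f̂(n))` into `ℓ²`; a tool for verifying the Hilbert
space axioms. -/
noncomputable def toL2 : WeightedHardy β →ₗ[ℂ] lp (fun _ : ℕ => ℂ) 2 where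
  toFun f := ⟨fun n => (β n : ℂ) * coeff f n,
    (weighted_summable_iff_memℓp β _).1 f.2.2.2⟩
  map_add' f g := by
    ext n
    change (β n : ℂ) * maclaurinCoeff (f.1 + g.1) n = _
    rw [maclaurinCoeff_add f.2.1 g.2.1, mul_add]
    rfl
  map_smul' c f := by
    ext n
    change (β n : ℂ) * maclaurinCoeff (c • f.1) n = c * ((β n : ℂ) * maclaurinCoeff f.1 n)
    rw [maclaurinCoeff_smul c f.2.1]
    ring

theorem toL2_apply (f : WeightedHardy β) (n : ℕ) : toL2 f n = (β n : ℂ) * coeff f n := rfl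

theorem toL2_injective : Function.Injective (toL2 (β := β)) := by
  intro f g h
  apply ext_coeff
  intro n
  have h1 : toL2 f n = toL2 g n := by rw [h]
  rw [toL2_apply, toL2_apply] at h1
  exact mul_left_cancel₀ (Complex.ofReal_ne_zero.2 (β.pos n).ne') h1

/-- The inner product `∑ f̂(n) conj(ĝ(n)) β(n)²`, written, as everywhere in Mathlib, so that it is
conjugate-linear in the first argument. -/
noncomputable instance : Inner ℂ (WeightedHardy β) :=
  ⟨fun g f => ∑' n, coeff f n * starRingEnd ℂ (coeff g n) * (β n : ℂ) ^ 2⟩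

theorem inner_def (f g : WeightedHardy β) :
    inner ℂ g f = ∑' n, coeff f n * starRingEnd ℂ (coeff g n) * (β n : ℂ) ^ 2 := rfl

theorem inner_eq_inner_toL2 (f g : WeightedHardy β) :
    inner ℂ g f = inner ℂ (toL2 g) (toL2 f) := by
  rw [inner_def, lp.inner_eq_tsum]
  refine tsum_congr fun n => ?_
  simp only [toL2_apply, RCLike.inner_apply, map_mul, Complex.conj_ofReal]
  ring

/-- The inner product axioms. -/
@[reducible] noncomputable def core (β : WeightSequence) :
    InnerProductSpace.Core ℂ (WeightedHardy β) where
  conj_inner_symm f g := by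
    rw [inner_eq_inner_toL2, inner_eq_inner_toL2]
    exact inner_conj_symm _ _
  re_inner_nonneg f := by
    rw [inner_eq_inner_toL2]
    exact inner_self_nonneg
  add_left f g h := by
    simp only [inner_eq_inner_toL2, map_add]
    exact inner_add_left _ _ _
  smul_left f g c := by
    simp only [inner_eq_inner_toL2, map_smul]
    exact inner_smul_left _ _ _
  definite f hf := by
    rw [inner_eq_inner_toL2, inner_self_eq_zero] at hf
    exact toL2_injective (by rw [hf, map_zero])

noncomputable instance : NormedAddCommGroup (WeightedHardy β) :=
  (core β).toNormedAddCommGroup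

noncomputable instance : InnerProductSpace ℂ (WeightedHardy β) :=
  InnerProductSpace.ofCore (core β).toCore

/-- The inner product of the Hilbert space structure is the explicit one. -/
theorem inner_eq_tsum (f g : WeightedHardy β) :
    @inner ℂ (WeightedHardy β) InnerProductSpace.toInner g f =
      ∑' n, coeff f n * starRingEnd ℂ (coeff g n) * (β n : ℂ) ^ 2 := rfl

theorem toL2_surjective : Function.Surjective (toL2 (β := β)) := by
  intro a
  set b : ℕ → ℂ := fun n => a n / (β n : ℂ) with hb
  set p := FormalMultilinearSeries.ofScalars ℂ b with hp
  have hrad : 1 ≤ p.radius := by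
    refine ENNReal.le_of_forall_nnreal_lt fun r hr => ?_
    have hr1 : (r : ℝ) < 1 := by exact_mod_cast hr
    obtain ⟨s, hs1, hs2⟩ := exists_between hr1
    have hs0 : 0 < s := r.2.trans_lt hs1
    refine p.le_radius_of_eventually_le ‖a‖ ?_
    filter_upwards [β.eventually_pow_le hs0 hs2] with n hn
    have hn' : (r : ℝ) ^ n ≤ β n := (pow_le_pow_left₀ r.2 hs1.le n).trans hn
    have ha : ‖a n‖ ≤ ‖a‖ := lp.norm_apply_le_norm (by norm_num) a n
    rw [hp, FormalMultilinearSeries.ofScalars_norm, hb, norm_div, Complex.norm_real,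
      Real.norm_of_nonneg (β.pos n).le, div_mul_eq_mul_div, div_le_iff₀ (β.pos n)]
    gcongr
  have hball := (p.hasFPowerSeriesOnBall (lt_of_lt_of_le one_pos hrad)).mono one_pos hrad
  set f : ℂ → ℂ := Set.indicator (Metric.ball 0 1) p.sum with hf
  have hfz : ∀ z ∈ Metric.ball (0 : ℂ) 1, f z = p.sum z := fun z hz => Set.indicator_of_mem hz _
  have hdiff : DifferentiableOn ℂ f (Metric.ball 0 1) := by
    have h := hball.differentiableOn
    have he : Metric.eball (0 : ℂ) 1 = Metric.ball 0 1 := by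
      simpa using Metric.eball_ofReal (x := (0 : ℂ)) (ε := 1)
    rw [he] at h
    exact h.congr hfz
  have hsum : ∀ z ∈ Metric.ball (0 : ℂ) 1, HasSum (fun n => b n * z ^ n) (f z) := by
    intro z hz
    have he : Metric.eball (0 : ℂ) 1 = Metric.ball 0 1 := by
      simpa using Metric.eball_ofReal (x := (0 : ℂ)) (ε := 1)
    rw [hfz z hz]
    have h := hball.hasSum (y := z) (by rw [he]; exact hz)
    simpa [hp, FormalMultilinearSeries.coeff_ofScalars, mul_comm] using h
  have hcoef : ∀ n, maclaurinCoeff f n = b n := maclaurinCoeff_eq_of_hasSum hsum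
  have hscale : (fun n => (β n : ℂ) * maclaurinCoeff f n) = a := by
    funext n
    rw [hcoef, hb]
    exact mul_div_cancel₀ _ (Complex.ofReal_ne_zero.2 (β.pos n).ne')
  refine ⟨⟨f, hdiff, fun z hz => Set.indicator_of_notMem hz _, ?_⟩, ?_⟩
  · rw [weighted_summable_iff_memℓp, hscale]
    exact lp.memℓp a
  · ext n
    exact congrFun hscale n

instance : CompleteSpace (WeightedHardy β) := by
  let J : WeightedHardy β ≃ₗᵢ[ℂ] lp (fun _ : ℕ => ℂ) 2 :=
    { LinearEquiv.ofBijective (toL2 (β := β)) ⟨toL2_injective, toL2_surjective⟩ with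
      norm_map' := fun f => by
        have h : ‖toL2 f‖ ^ 2 = ‖f‖ ^ 2 := by
          rw [← inner_self_eq_norm_sq (𝕜 := ℂ), ← inner_self_eq_norm_sq (𝕜 := ℂ),
            inner_eq_inner_toL2]
        exact (pow_left_inj₀ (norm_nonneg _) (norm_nonneg _) two_ne_zero).1 h }
  exact J.toIsometryEquiv.completeSpace_iff.2 inferInstance

/-- The monomial `z ↦ z ^ m` as an element of `H²(β)`. -/
noncomputable def monomial (β : WeightSequence) (m : ℕ) : WeightedHardy β :=
  ⟨Set.indicator (Metric.ball 0 1) (fun z => z ^ m),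
    (differentiableOn_pow m).congr fun _ hz => Set.indicator_of_mem hz _,
    fun _ hz => Set.indicator_of_notMem hz _, by
      have hc : ∀ n, maclaurinCoeff (Set.indicator (Metric.ball 0 1) (fun z : ℂ => z ^ m)) n =
          if n = m then 1 else 0 := by
        refine maclaurinCoeff_eq_of_hasSum fun z hz => ?_
        rw [Set.indicator_of_mem hz]
        convert hasSum_ite_eq m (z ^ m) using 2 with n
        split_ifs with h <;> simp [h]
      refine summable_of_ne_finset_zero (s := {m}) fun n hn => ?_
      have hn' : n ≠ m := by simpa using hn
      simp [hc, hn']⟩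

/-- The bounded operator `T` on `H²(β)` is the weighted composition operator
`f ↦ ψ · (f ∘ φ)`. For a selfmap `φ` of the disc, the existence of such a `T` says
that `f ↦ ψ · (f ∘ φ)` maps `H²(β)` boundedly into itself, and `T` is then unique. -/
def IsWeightedComposition (ψ φ : ℂ → ℂ) (T : WeightedHardy β →L[ℂ] WeightedHardy β) : Prop :=
  ∀ f : WeightedHardy β, ∀ z ∈ Metric.ball (0 : ℂ) 1, T f z = ψ z * f (φ z)

end WeightedHardy

/-! (ii) → (iii). Write `K_w(z) = k(conj w * z)` for the reproducing kernel and `a₀ = φ 0`. Pairing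
`W* zⁿ = W zⁿ` with `K_w` shows that `ψ φⁿ` at `w` is, up to `β(n)²` and conjugation, the `n`-th
Maclaurin coefficient of `W K_w` (`IsWeightedComposition.mul_pow_eq`). For `n = 0` this determines
`ψ`, and for `n = 1` it determines `φ`. For `n = 2` it must be compatible with the first two, which
forces `k k'' = (2β(1)⁴/β(2)²) k'²`. Hence `k/k'` is affine and `k` solves `(1 - λu) k' = k/β(1)²`,
whose solutions are the exponential and the powers. Positivity of the coefficients of `k` gives `λ ≥
0`, and `k ≥ 1` on `[0, 1)` gives `λ ≤ 1`.

(iii) → (i). The differential equation turns `φ` into a linear fractional map, and `k(u) k(v)`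
depends only on `u + v - λuv`. Together these give `W K_w = conj (ψ w) K_{φ w}`, so `W` is symmetric
on the span of the kernels. The real issue is boundedness. The iterates satisfy `‖Wⁿ K_w‖ ≤ Mⁿ
‖K_w‖`, because `ψ` is bounded and Schwarz–Pick compares `‖K_{φ w}‖² = k(|φ w|²)` with `‖K_w‖² =
k(|w|²)`. For a symmetric operator, growth of the iterates at rate `M` at each vector already
implies the norm bound `M` (`LinearMap.IsSymmetric.norm_apply_le_of_norm_pow_le`), so `W` extends to
a bounded self-adjoint operator. -/

/-! ### Analytic properties of the generating function. -/

namespace WeightSequence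

variable (β : WeightSequence)

theorem hasFPowerSeriesOnBall_generatingFunction :
    HasFPowerSeriesOnBall β.generatingFunction
      (FormalMultilinearSeries.ofScalars ℂ fun j => 1 / (β j : ℂ) ^ 2) 0 1 := by
  refine ⟨?_, one_pos, ?_⟩
  · refine ENNReal.le_of_forall_nnreal_lt fun r hr => ?_
    have hr1 : (r : ℝ) < 1 := by exact_mod_cast hr
    refine FormalMultilinearSeries.le_radius_of_summable _ ?_
    have h := (β.hasSum_generatingFunction (z := ((r : ℝ) : ℂ)) (by simpa using hr1)).summable.norm
    refine h.congr fun n => ?_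
    rw [FormalMultilinearSeries.ofScalars_norm]
    simp [div_eq_mul_inv, mul_comm]
  · intro y hy
    have hy' : y ∈ Metric.ball (0 : ℂ) 1 := by
      simpa [← Metric.eball_ofReal] using hy
    have h := β.hasSum_generatingFunction hy'
    simpa [FormalMultilinearSeries.ofScalars_apply_eq, div_eq_mul_inv, mul_comm] using h

theorem differentiableOn_generatingFunction :
    DifferentiableOn ℂ β.generatingFunction (Metric.ball 0 1) := by
  have h := β.hasFPowerSeriesOnBall_generatingFunction.differentiableOn
  rwa [show Metric.eball (0 : ℂ) 1 = Metric.ball 0 1 by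
    simpa using Metric.eball_ofReal (x := (0 : ℂ)) (ε := 1)] at h

theorem iteratedDeriv_generatingFunction_zero (n : ℕ) :
    iteratedDeriv n β.generatingFunction 0 = n.factorial / (β n : ℂ) ^ 2 := by
  have h := maclaurinCoeff_eq_of_hasSum (f := β.generatingFunction)
    (a := fun j => 1 / (β j : ℂ) ^ 2) (fun z hz => by
      simpa [div_eq_mul_inv, mul_comm] using β.hasSum_generatingFunction hz) n
  have hn : (n.factorial : ℂ) ≠ 0 := Nat.cast_ne_zero.2 n.factorial_ne_zero
  rw [maclaurinCoeff, div_eq_iff hn] at h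
  rw [h]
  ring

theorem generatingFunction_zero : β.generatingFunction 0 = 1 := by
  simpa [β.map_zero] using β.iteratedDeriv_generatingFunction_zero 0

theorem deriv_generatingFunction_zero :
    deriv β.generatingFunction 0 = 1 / (β 1 : ℂ) ^ 2 := by
  simpa using β.iteratedDeriv_generatingFunction_zero 1

/-- The Maclaurin coefficients are real. This symmetry removes the conjugations from the coefficient
identities. -/
theorem generatingFunction_conj (z : ℂ) :
    β.generatingFunction (starRingEnd ℂ z) = starRingEnd ℂ (β.generatingFunction z) := by
  simp only [generatingFunction, Complex.conj_tsum]
  refine tsum_congr fun n => ?_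
  simp

theorem deriv_generatingFunction_conj (z : ℂ) :
    deriv β.generatingFunction (starRingEnd ℂ z) =
      starRingEnd ℂ (deriv β.generatingFunction z) := by
  have h : (starRingEnd ℂ ∘ β.generatingFunction ∘ starRingEnd ℂ) = β.generatingFunction := by
    funext z
    simp [generatingFunction_conj]
  have h1 := congrFun (deriv_conj_conj (𝕜 := ℂ) (f := β.generatingFunction)) (starRingEnd ℂ z)
  simpa [h] using h1

theorem deriv_deriv_generatingFunction_conj (z : ℂ) :
    deriv (deriv β.generatingFunction) (starRingEnd ℂ z) =
      starRingEnd ℂ (deriv (deriv β.generatingFunction) z) := by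
  have h : (starRingEnd ℂ ∘ deriv β.generatingFunction ∘ starRingEnd ℂ) =
      deriv β.generatingFunction := by
    funext z
    simp [deriv_generatingFunction_conj]
  have h1 := congrFun (deriv_conj_conj (𝕜 := ℂ) (f := deriv β.generatingFunction))
    (starRingEnd ℂ z)
  simpa [h] using h1

/-- The generating function is at least `1` on `[0, 1)`. -/
theorem one_le_re_generatingFunction {x : ℝ} (h0 : 0 ≤ x) (h1 : x < 1) :
    1 ≤ (β.generatingFunction x).re := by
  have hx : (x : ℂ) ∈ Metric.ball (0 : ℂ) 1 := by simpa [abs_of_nonneg h0] using h1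
  have h := Complex.hasSum_re (β.hasSum_generatingFunction hx)
  have h2 : ∀ n, ((x : ℂ) ^ n / (β n : ℂ) ^ 2).re = x ^ n / β n ^ 2 := fun n => by
    rw [← Complex.ofReal_pow, ← Complex.ofReal_pow, ← Complex.ofReal_div, Complex.ofReal_re]
  have h3 := h.summable.le_tsum 0 (fun n _ => by rw [h2]; positivity)
  rw [h.tsum_eq, h2] at h3
  simpa [β.map_zero] using h3

end WeightSequence

/-! ### Reproducing kernels and monomials in `H²(β)`. -/

theorem conj_mul_mem_ball {w z : ℂ} (hw : w ∈ Metric.ball (0 : ℂ) 1)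
    (hz : z ∈ Metric.ball (0 : ℂ) 1) : starRingEnd ℂ w * z ∈ Metric.ball (0 : ℂ) 1 := by
  simp only [mem_ball_zero_iff, norm_mul, RCLike.norm_conj] at *
  exact mul_lt_one_of_nonneg_of_lt_one_left (norm_nonneg _) hw hz.le

namespace WeightedHardy

variable {β : WeightSequence}

theorem ext_ball {f g : WeightedHardy β} (h : ∀ z ∈ Metric.ball (0 : ℂ) 1, f z = g z) :
    f = g := by
  apply Subtype.ext
  funext z
  by_cases hz : z ∈ Metric.ball (0 : ℂ) 1
  · exact h z hz
  · rw [f.2.2.1 z hz, g.2.2.1 z hz]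

theorem add_apply (f g : WeightedHardy β) (z : ℂ) : (f + g) z = f z + g z := rfl

theorem smul_apply (c : ℂ) (f : WeightedHardy β) (z : ℂ) : (c • f) z = c * f z := rfl

theorem zero_apply (z : ℂ) : (0 : WeightedHardy β) z = 0 := rfl

theorem maclaurinCoeff_kernel {w : ℂ} (hw : w ∈ Metric.ball (0 : ℂ) 1) (n : ℕ) :
    maclaurinCoeff (Set.indicator (Metric.ball 0 1)
      (fun z => β.generatingFunction (starRingEnd ℂ w * z))) n =
      starRingEnd ℂ w ^ n / (β n : ℂ) ^ 2 := by
  refine maclaurinCoeff_eq_of_hasSum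
    (a := fun n => starRingEnd ℂ w ^ n / (β n : ℂ) ^ 2) (fun z hz => ?_) n
  rw [Set.indicator_of_mem hz]
  refine (β.hasSum_generatingFunction (conj_mul_mem_ball hw hz)).congr_fun ?_
  intro n
  ring

/-- The reproducing kernel `K_w(z) = k(conj w * z)` of `H²(β)`. -/
noncomputable def kernel (β : WeightSequence) (w : Metric.ball (0 : ℂ) 1) : WeightedHardy β :=
  ⟨Set.indicator (Metric.ball 0 1) (fun z => β.generatingFunction (starRingEnd ℂ (w : ℂ) * z)),
    DifferentiableOn.congr
      (β.differentiableOn_generatingFunction.comp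
        (differentiable_id.const_mul (starRingEnd ℂ (w : ℂ))).differentiableOn
        fun _ hz => conj_mul_mem_ball w.2 hz)
      fun _ hz => Set.indicator_of_mem hz _,
    fun _ hz => Set.indicator_of_notMem hz _, by
      simp_rw [maclaurinCoeff_kernel w.2]
      refine (β.hasSum_generatingFunction (conj_mul_mem_ball w.2 w.2)).summable.norm.congr
        fun n => ?_
      have := (β.pos n).ne'
      simp only [norm_div, norm_pow, norm_mul, RCLike.norm_conj, Complex.norm_real,
        Real.norm_eq_abs, sq_abs]
      field_simp
      ring⟩

theorem kernel_apply (w : Metric.ball (0 : ℂ) 1) {z : ℂ} (hz : z ∈ Metric.ball (0 : ℂ) 1) :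
    kernel β w z = β.generatingFunction (starRingEnd ℂ (w : ℂ) * z) :=
  Set.indicator_of_mem hz fun z => β.generatingFunction (starRingEnd ℂ (w : ℂ) * z)

/-- The reproducing property. -/
theorem inner_kernel (w : Metric.ball (0 : ℂ) 1) (f : WeightedHardy β) :
    inner ℂ (kernel β w) f = f w := by
  rw [inner_eq_tsum, ← (maclaurinCoeff_hasSum f.2.1 w.2).tsum_eq]
  refine tsum_congr fun n => ?_
  have h : (β n : ℂ) ≠ 0 := Complex.ofReal_ne_zero.2 (β.pos n).ne'
  rw [coeff, coeff, show maclaurinCoeff (kernel β w) n = _ from maclaurinCoeff_kernel w.2 n]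
  simp only [map_div₀, map_pow, Complex.conj_conj, Complex.conj_ofReal]
  field_simp

theorem monomial_apply (m : ℕ) {z : ℂ} (hz : z ∈ Metric.ball (0 : ℂ) 1) :
    monomial β m z = z ^ m := Set.indicator_of_mem hz _

theorem coeff_monomial (m n : ℕ) : coeff (monomial β m) n = if n = m then 1 else 0 := by
  refine maclaurinCoeff_eq_of_hasSum (a := fun n => if n = m then 1 else 0) (fun z hz => ?_) n
  rw [monomial_apply m hz]
  convert hasSum_ite_eq m (z ^ m) using 2 with n
  split_ifs with h <;> simp [h]

theorem inner_monomial (m : ℕ) (f : WeightedHardy β) :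
    inner ℂ (monomial β m) f = coeff f m * (β m : ℂ) ^ 2 := by
  rw [inner_eq_tsum, tsum_eq_single m]
  · simp [coeff_monomial]
  · intro n hn
    simp [coeff_monomial, hn]

theorem norm_kernel_sq (w : Metric.ball (0 : ℂ) 1) :
    ‖kernel β w‖ ^ 2 = (β.generatingFunction ((‖(w : ℂ)‖ ^ 2 : ℝ) : ℂ)).re := by
  rw [← inner_self_eq_norm_sq (𝕜 := ℂ), inner_kernel, kernel_apply w w.2, Complex.conj_mul']
  simp

/-- A function orthogonal to every kernel vanishes at every point of the disc. -/
theorem span_kernel_dense : Dense (Submodule.span ℂ (Set.range (kernel β)) : Set (WeightedHardy β)) := by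
  rw [Submodule.dense_iff_topologicalClosure_eq_top, Submodule.topologicalClosure_eq_top_iff,
    Submodule.eq_bot_iff]
  intro f hf
  refine ext_ball fun z hz => ?_
  rw [← inner_kernel ⟨z, hz⟩]
  exact (Submodule.mem_orthogonal _ _).1 hf _ (Submodule.subset_span ⟨_, rfl⟩)

end WeightedHardy

/-! ### Second derivatives of products and compositions. -/

section SecondDerivatives

variable {f g : ℂ → ℂ} {U : Set ℂ}

theorem deriv_deriv_mul_of_isOpen (hU : IsOpen U) (hf : DifferentiableOn ℂ f U)
    (hg : DifferentiableOn ℂ g U) {z : ℂ} (hz : z ∈ U) :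
    deriv (deriv fun x => f x * g x) z =
      deriv (deriv f) z * g z + 2 * (deriv f z * deriv g z) + f z * deriv (deriv g) z := by
  have hd : ∀ {h : ℂ → ℂ}, DifferentiableOn ℂ h U → ∀ x ∈ U, DifferentiableAt ℂ h x :=
    fun h x hx => h.differentiableAt (hU.mem_nhds hx)
  have he : (deriv fun x => f x * g x) =ᶠ[nhds z] fun x => deriv f x * g x + f x * deriv g x := by
    filter_upwards [hU.mem_nhds hz] with x hx
    exact deriv_fun_mul (hd hf x hx) (hd hg x hx)
  rw [he.deriv_eq, deriv_fun_add ((hd (hf.deriv hU) z hz).fun_mul (hd hg z hz))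
    ((hd hf z hz).fun_mul (hd (hg.deriv hU) z hz)),
    deriv_fun_mul (hd (hf.deriv hU) z hz) (hd hg z hz),
    deriv_fun_mul (hd hf z hz) (hd (hg.deriv hU) z hz)]
  ring

theorem deriv_deriv_comp_of_isOpen {V : Set ℂ} (hU : IsOpen U) (hV : IsOpen V)
    (hf : DifferentiableOn ℂ f V) (hg : DifferentiableOn ℂ g U) (h : Set.MapsTo g U V)
    {z : ℂ} (hz : z ∈ U) :
    deriv (deriv fun x => f (g x)) z =
      deriv (deriv f) (g z) * deriv g z ^ 2 + deriv f (g z) * deriv (deriv g) z := by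
  have hd : ∀ {h : ℂ → ℂ}, DifferentiableOn ℂ h U → ∀ x ∈ U, DifferentiableAt ℂ h x :=
    fun h x hx => h.differentiableAt (hU.mem_nhds hx)
  have hd' : ∀ {h : ℂ → ℂ}, DifferentiableOn ℂ h V → ∀ x ∈ V, DifferentiableAt ℂ h x :=
    fun h x hx => h.differentiableAt (hV.mem_nhds hx)
  have hc : ∀ {k : ℂ → ℂ}, DifferentiableOn ℂ k V → ∀ x ∈ U,
      deriv (fun x => k (g x)) x = deriv k (g x) * deriv g x :=
    fun hk x hx => deriv_comp x (hd' hk _ (h hx)) (hd hg x hx)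
  have he : (deriv fun x => f (g x)) =ᶠ[nhds z] fun x => deriv f (g x) * deriv g x := by
    filter_upwards [hU.mem_nhds hz] with x hx
    exact hc hf x hx
  have h1 : DifferentiableAt ℂ (fun x => deriv f (g x)) z :=
    (hd' (hf.deriv hV) _ (h hz)).comp z (hd hg z hz)
  rw [he.deriv_eq, deriv_fun_mul h1 (hd (hg.deriv hU) z hz), hc (hf.deriv hV) z hz]
  ring

end SecondDerivatives

/-! ### From the quadratic differential equation to the closed forms of `k`. -/

namespace WeightSequence

variable (β : WeightSequence)

theorem deriv_deriv_generatingFunction_zero :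
    deriv (deriv β.generatingFunction) 0 = 2 / (β 2 : ℂ) ^ 2 := by
  have h := β.iteratedDeriv_generatingFunction_zero 2
  rw [iteratedDeriv_succ, iteratedDeriv_one] at h
  simpa using h

theorem ofReal_ne_zero (n : ℕ) : (β n : ℂ) ≠ 0 := Complex.ofReal_ne_zero.2 (β.pos n).ne'

/-- If `k k'' = (1 + l β₁²) (k')²` near the origin, then `k` solves a linear differential equation
of first order on the whole disc. -/
theorem linear_ode_of_quadratic_ode (l : ℂ)
    (h : ∀ᶠ u in nhds (0 : ℂ), β.generatingFunction u * deriv (deriv β.generatingFunction) u =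
      (1 + l * (β 1 : ℂ) ^ 2) * deriv β.generatingFunction u ^ 2) :
    ∀ u ∈ Metric.ball (0 : ℂ) 1,
      (1 - l * u) * deriv β.generatingFunction u =
        1 / (β 1 : ℂ) ^ 2 * β.generatingFunction u := by
  set k := β.generatingFunction with hk
  have hkd : DifferentiableOn ℂ k (Metric.ball 0 1) := β.differentiableOn_generatingFunction
  have hkd1 : DifferentiableOn ℂ (deriv k) (Metric.ball 0 1) := hkd.deriv Metric.isOpen_ball
  have h0 : Metric.ball (0 : ℂ) 1 ∈ nhds (0 : ℂ) := Metric.ball_mem_nhds _ one_pos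
  have hb := β.ofReal_ne_zero 1
  have hne : ∀ᶠ u in nhds (0 : ℂ), deriv k u ≠ 0 := by
    refine (hkd1.continuousOn.continuousAt h0).eventually_ne ?_
    rw [hk, β.deriv_generatingFunction_zero]
    exact one_div_ne_zero (pow_ne_zero _ hb)
  obtain ⟨r, hr, hball⟩ := Metric.eventually_nhds_iff_ball.1 ((h.and hne).and h0)
  -- The hypothesis says `(k/k')' = 1 - k k''/k'² = -l β(1)²`. So `k/k'` is affine near `0`, with
  -- value `β(1)²` at `0`.
  have hder : ∀ u ∈ Metric.ball (0 : ℂ) r,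
      HasDerivAt (fun u => k u / deriv k u + l * (β 1 : ℂ) ^ 2 * u) 0 u := by
    intro u hu
    obtain ⟨⟨h1, h2⟩, h3⟩ := hball u hu
    have hn := Metric.isOpen_ball.mem_nhds h3
    have := ((hkd.differentiableAt hn).hasDerivAt.div (hkd1.differentiableAt hn).hasDerivAt h2).add
      ((hasDerivAt_id u).const_mul (l * (β 1 : ℂ) ^ 2))
    refine this.congr_deriv ?_
    rw [h1]
    field_simp
    ring
  have hconst : ∀ u ∈ Metric.ball (0 : ℂ) r,
      k u / deriv k u + l * (β 1 : ℂ) ^ 2 * u = (β 1 : ℂ) ^ 2 := by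
    intro u hu
    have h1 := Metric.isOpen_ball.is_const_of_deriv_eq_zero
      (convex_ball (0 : ℂ) r).isPreconnected
      (fun u hu => (hder u hu).differentiableAt.differentiableWithinAt)
      (fun u hu => (hder u hu).deriv) hu (Metric.mem_ball_self hr)
    rw [h1, hk, β.deriv_generatingFunction_zero, β.generatingFunction_zero]
    simp
  have hloc : (fun u => (1 - l * u) * deriv k u) =ᶠ[nhds 0]
      fun u => 1 / (β 1 : ℂ) ^ 2 * k u := by
    filter_upwards [Metric.ball_mem_nhds (0 : ℂ) hr] with u hu
    have h1 := hconst u hu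
    have h2 := (hball u hu).1.2
    field_simp at h1 ⊢
    linear_combination -h1
  have hl : DifferentiableOn ℂ (fun u : ℂ => 1 - l * u) (Metric.ball 0 1) := by fun_prop
  exact ((hl.mul hkd1).analyticOnNhd Metric.isOpen_ball).eqOn_of_preconnected_of_eventuallyEq
    ((hkd.const_mul _).analyticOnNhd Metric.isOpen_ball)
    (convex_ball (0 : ℂ) 1).isPreconnected (Metric.mem_ball_self one_pos) hloc

variable {β}

/-- The higher derivatives of a solution of the first order equation. -/
theorem iteratedDeriv_of_linear_ode {l : ℂ}
    (h : ∀ u ∈ Metric.ball (0 : ℂ) 1, (1 - l * u) * deriv β.generatingFunction u =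
        1 / (β 1 : ℂ) ^ 2 * β.generatingFunction u) (n : ℕ) :
    ∀ u ∈ Metric.ball (0 : ℂ) 1, (1 - l * u) * iteratedDeriv (n + 1) β.generatingFunction u =
        (1 / (β 1 : ℂ) ^ 2 + n * l) * iteratedDeriv n β.generatingFunction u := by
  have hd : ∀ n, ∀ u ∈ Metric.ball (0 : ℂ) 1,
      HasDerivAt (iteratedDeriv n β.generatingFunction)
        (iteratedDeriv (n + 1) β.generatingFunction u) u := by
    intro n u hu
    have h1 : DifferentiableOn ℂ (iteratedDeriv n β.generatingFunction) (Metric.ball 0 1) := by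
      induction n with
      | zero => simpa using β.differentiableOn_generatingFunction
      | succ n ih =>
        rw [iteratedDeriv_succ]
        exact ih.deriv Metric.isOpen_ball
    rw [iteratedDeriv_succ]
    exact (h1.differentiableAt (Metric.isOpen_ball.mem_nhds hu)).hasDerivAt
  induction n with
  | zero => simpa [iteratedDeriv_one] using h
  | succ n ih =>
    intro u hu
    have h1 := (((hasDerivAt_id u).const_mul l).const_sub 1).mul (hd (n + 1) u hu)
    have h2 := (hd n u hu).const_mul (1 / (β 1 : ℂ) ^ 2 + n * l)
    have he : ((fun u => 1 - l * id u) * iteratedDeriv (n + 1) β.generatingFunction) =ᶠ[nhds u]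
        fun u => (1 / (β 1 : ℂ) ^ 2 + n * l) * iteratedDeriv n β.generatingFunction u := by
      filter_upwards [Metric.isOpen_ball.mem_nhds hu] with x hx using ih x hx
    have h3 := (h1.congr_of_eventuallyEq he.symm).unique h2
    simp only [id] at h3
    push_cast
    linear_combination h3

/-- At the origin the recursion for the derivatives reads `(n+1)!/β(n+1)² = (1/β(1)² + n l) ·
n!/β(n)²`. The middle factor is therefore positive for every `n`, which is impossible if `l < 0`. -/
theorem nonneg_of_linear_ode {l : ℝ}
    (h : ∀ u ∈ Metric.ball (0 : ℂ) 1, (1 - (l : ℂ) * u) * deriv β.generatingFunction u =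
        1 / (β 1 : ℂ) ^ 2 * β.generatingFunction u) : 0 ≤ l := by
  have key : ∀ n : ℕ, 0 < 1 / β 1 ^ 2 + n * l := by
    intro n
    have h1 := iteratedDeriv_of_linear_ode h n 0 (Metric.mem_ball_self one_pos)
    rw [β.iteratedDeriv_generatingFunction_zero, β.iteratedDeriv_generatingFunction_zero] at h1
    have h2 : ((n + 1).factorial : ℝ) / β (n + 1) ^ 2 =
        (1 / β 1 ^ 2 + n * l) * (n.factorial / β n ^ 2) := by
      have h1' : (((n + 1).factorial : ℝ) / β (n + 1) ^ 2 : ℂ) =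
        (((1 / β 1 ^ 2 + n * l) * (n.factorial / β n ^ 2) : ℝ) : ℂ) := by
        push_cast
        simpa using h1
      exact_mod_cast h1'
    have p1 := β.pos n
    have p2 := β.pos (n + 1)
    have h3 : 0 < ((n + 1).factorial : ℝ) / β (n + 1) ^ 2 := by positivity
    rw [h2] at h3
    exact pos_of_mul_pos_left h3 (by positivity)
  by_contra! hl
  obtain ⟨n, hn⟩ := exists_nat_gt ((1 / β 1 ^ 2) / (-l))
  rw [div_lt_iff₀ (by linarith)] at hn
  linarith [key n]

/-- If `l > 1`, the singular point `1/l` lies in the disc and the equation forces `k(1/l) = 0`,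
against `k ≥ 1` on `[0, 1)`. -/
theorem le_one_of_linear_ode {l : ℝ}
    (h : ∀ u ∈ Metric.ball (0 : ℂ) 1, (1 - (l : ℂ) * u) * deriv β.generatingFunction u =
        1 / (β 1 : ℂ) ^ 2 * β.generatingFunction u) : l ≤ 1 := by
  by_contra! hl
  have h0 : 0 ≤ 1 / l := by positivity
  have h1 : 1 / l < 1 := (div_lt_one (by linarith)).2 hl
  have hlc : (l : ℂ) ≠ 0 := Complex.ofReal_ne_zero.2 (by linarith)
  have h2 := h ((1 / l : ℝ) : ℂ) (by simpa [abs_of_nonneg (zero_le_one.trans hl.le)] using h1)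
  have h3 : β.generatingFunction ((1 / l : ℝ) : ℂ) = 0 := by
    have hb := β.ofReal_ne_zero 1
    push_cast at h2 ⊢
    rw [mul_one_div_cancel hlc, sub_self, zero_mul, zero_eq_mul] at h2
    exact h2.resolve_left (one_div_ne_zero (pow_ne_zero _ hb))
  have h4 := β.one_le_re_generatingFunction h0 h1
  rw [h3, Complex.zero_re] at h4
  linarith

theorem generatingFunction_eq_exp_of_linear_ode
    (h : ∀ u ∈ Metric.ball (0 : ℂ) 1, deriv β.generatingFunction u =
        1 / (β 1 : ℂ) ^ 2 * β.generatingFunction u) :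
    ∀ z ∈ Metric.ball (0 : ℂ) 1, β.generatingFunction z = Complex.exp (z / (β 1 : ℂ) ^ 2) := by
  have hder : ∀ u ∈ Metric.ball (0 : ℂ) 1, HasDerivAt
      (fun u => β.generatingFunction u * Complex.exp (-(u / (β 1 : ℂ) ^ 2))) 0 u := by
    intro u hu
    have h1 := (β.differentiableOn_generatingFunction.differentiableAt
      (Metric.isOpen_ball.mem_nhds hu)).hasDerivAt.mul
      (((hasDerivAt_id u).div_const ((β 1 : ℂ) ^ 2)).neg.cexp)
    refine h1.congr_deriv ?_
    rw [h u hu]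
    simp
    ring
  intro z hz
  have h1 := Metric.isOpen_ball.is_const_of_deriv_eq_zero
    (convex_ball (0 : ℂ) 1).isPreconnected
    (fun u hu => (hder u hu).differentiableAt.differentiableWithinAt)
    (fun u hu => (hder u hu).deriv) hz (Metric.mem_ball_self one_pos)
  simp only [β.generatingFunction_zero, zero_div, neg_zero, Complex.exp_zero, mul_one] at h1
  rw [Complex.exp_neg, mul_inv_eq_one₀ (Complex.exp_ne_zero _)] at h1
  exact h1

end WeightSequence

/-- Staying in the right half-plane keeps `1 - l u` off the branch cut, so its principal powers are
holomorphic on the disc. -/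
theorem re_one_sub_mul_pos {l : ℝ} (h0 : 0 ≤ l) (h1 : l ≤ 1) {u : ℂ}
    (hu : u ∈ Metric.ball (0 : ℂ) 1) : 0 < (1 - (l : ℂ) * u).re := by
  have h2 : u.re < 1 := (Complex.re_le_norm u).trans_lt (by simpa using hu)
  simp only [Complex.sub_re, Complex.one_re, Complex.re_ofReal_mul]
  rcases h0.eq_or_lt with rfl | h0
  · simp
  · nlinarith

theorem one_sub_mul_ne_zero {l : ℝ} (h0 : 0 ≤ l) (h1 : l ≤ 1) {u : ℂ}
    (hu : u ∈ Metric.ball (0 : ℂ) 1) : 1 - (l : ℂ) * u ≠ 0 := fun h => by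
  have := re_one_sub_mul_pos h0 h1 hu
  rw [h, Complex.zero_re] at this
  exact lt_irrefl _ this

theorem hasDerivAt_one_sub_mul_cpow {l : ℝ} (h0 : 0 ≤ l) (h1 : l ≤ 1) {u : ℂ}
    (hu : u ∈ Metric.ball (0 : ℂ) 1) (p : ℂ) :
    HasDerivAt (fun u : ℂ => (1 - (l : ℂ) * u) ^ p)
      (-(p * l * (1 - (l : ℂ) * u) ^ p / (1 - (l : ℂ) * u))) u := by
  have h2 := (((hasDerivAt_id u).const_mul (l : ℂ)).const_sub 1).cpow_const (c := p)
    (Or.inl (re_one_sub_mul_pos h0 h1 hu))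
  refine h2.congr_deriv ?_
  simp only [id]
  rw [Complex.cpow_sub _ _ (one_sub_mul_ne_zero h0 h1 hu), Complex.cpow_one]
  ring

namespace WeightSequence

variable {β : WeightSequence}

theorem generatingFunction_eq_cpow_of_linear_ode {l : ℝ} (h0 : 0 < l) (hl : l ≤ 1)
    (h : ∀ u ∈ Metric.ball (0 : ℂ) 1, (1 - (l : ℂ) * u) * deriv β.generatingFunction u =
        1 / (β 1 : ℂ) ^ 2 * β.generatingFunction u) :
    ∀ z ∈ Metric.ball (0 : ℂ) 1, β.generatingFunction z =
      (1 - (l : ℂ) * z) ^ (-(1 / ((l : ℂ) * (β 1 : ℂ) ^ 2))) := by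
  set p : ℂ := 1 / ((l : ℂ) * (β 1 : ℂ) ^ 2) with hp
  have hlc : (l : ℂ) ≠ 0 := Complex.ofReal_ne_zero.2 h0.ne'
  have hb := β.ofReal_ne_zero 1
  have hpl : p * l = 1 / (β 1 : ℂ) ^ 2 := by rw [hp]; field_simp
  have hder : ∀ u ∈ Metric.ball (0 : ℂ) 1, HasDerivAt
      (fun u => β.generatingFunction u * (1 - (l : ℂ) * u) ^ p) 0 u := by
    intro u hu
    have h1 := (β.differentiableOn_generatingFunction.differentiableAt
      (Metric.isOpen_ball.mem_nhds hu)).hasDerivAt.mul (hasDerivAt_one_sub_mul_cpow h0.le hl hu p)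
    refine h1.congr_deriv ?_
    have h2 := one_sub_mul_ne_zero h0.le hl hu
    rw [hpl, show deriv β.generatingFunction u =
      1 / (β 1 : ℂ) ^ 2 * β.generatingFunction u / (1 - (l : ℂ) * u) by
        rw [← h u hu, mul_div_cancel_left₀ _ h2]]
    ring
  intro z hz
  have h1 := Metric.isOpen_ball.is_const_of_deriv_eq_zero
    (convex_ball (0 : ℂ) 1).isPreconnected
    (fun u hu => (hder u hu).differentiableAt.differentiableWithinAt)
    (fun u hu => (hder u hu).deriv) hz (Metric.mem_ball_self one_pos)
  simp only [β.generatingFunction_zero, mul_zero, sub_zero, Complex.one_cpow, mul_one] at h1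
  rw [Complex.cpow_neg]
  refine eq_inv_of_mul_eq_one_left h1

end WeightSequence

/-! ### Coefficient identities and what they force on `ψ`, `φ` and `k`. -/

namespace WeightedHardy

variable {β : WeightSequence}

/-- If `W` and its adjoint agree at `zⁿ`, then testing against reproducing kernels gives an identity
between `ψ φⁿ` and the `n`-th coefficients of `W K_w`. -/
theorem IsWeightedComposition.mul_pow_eq {ψ φ : ℂ → ℂ}
    {W : WeightedHardy β →L[ℂ] WeightedHardy β}
    (hφ_self : Set.MapsTo φ (Metric.ball 0 1) (Metric.ball 0 1))
    (hW : IsWeightedComposition ψ φ W) {n : ℕ}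
    (h : ContinuousLinearMap.adjoint W (monomial β n) = W (monomial β n))
    {w : ℂ} (hw : w ∈ Metric.ball (0 : ℂ) 1) :
    ψ w * φ w ^ n = (β n : ℂ) ^ 2 * starRingEnd ℂ
      (maclaurinCoeff (fun z => ψ z * β.generatingFunction (starRingEnd ℂ w * φ z)) n) := by
  have h1 : ψ w * φ w ^ n = inner ℂ (kernel β ⟨w, hw⟩) (W (monomial β n)) := by
    rw [inner_kernel, hW _ w hw, monomial_apply n (hφ_self hw)]
  have h2 : coeff (W (kernel β ⟨w, hw⟩)) n =
      maclaurinCoeff (fun z => ψ z * β.generatingFunction (starRingEnd ℂ w * φ z)) n := by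
    rw [coeff, maclaurinCoeff, maclaurinCoeff]
    congr 1
    refine Filter.EventuallyEq.iteratedDeriv_eq n ?_
    filter_upwards [Metric.ball_mem_nhds (0 : ℂ) one_pos] with z hz
    rw [hW _ z hz, kernel_apply _ (hφ_self hz)]
  rw [h1, ← h, ContinuousLinearMap.adjoint_inner_right, ← inner_conj_symm, inner_monomial, h2,
    map_mul, map_pow, Complex.conj_ofReal, mul_comm]

end WeightedHardy

section Symbols

variable {β : WeightSequence} {φ ψ : ℂ → ℂ}

theorem maclaurinCoeff_one (f : ℂ → ℂ) : maclaurinCoeff f 1 = deriv f 0 := by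
  simp [maclaurinCoeff]

theorem maclaurinCoeff_two (f : ℂ → ℂ) : maclaurinCoeff f 2 = deriv (deriv f) 0 / 2 := by
  rw [maclaurinCoeff, iteratedDeriv_succ, iteratedDeriv_one]
  simp

/-- The zeroth coefficient identity determines `ψ`. -/
theorem weight_eq_of_coeff_zero (hψ_ne : ∃ z ∈ Metric.ball (0 : ℂ) 1, ψ z ≠ 0)
    (h : ∀ w ∈ Metric.ball (0 : ℂ) 1, ψ w * φ w ^ 0 = (β 0 : ℂ) ^ 2 * starRingEnd ℂ
      (maclaurinCoeff (fun z => ψ z * β.generatingFunction (starRingEnd ℂ w * φ z)) 0)) :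
    ∃ c : ℝ, c ≠ 0 ∧ ψ 0 = c ∧ ∀ z ∈ Metric.ball (0 : ℂ) 1,
      ψ z = c * β.generatingFunction (starRingEnd ℂ (φ 0) * z) := by
  have h1 : ∀ w ∈ Metric.ball (0 : ℂ) 1,
      ψ w = starRingEnd ℂ (ψ 0) * β.generatingFunction (starRingEnd ℂ (φ 0) * w) := by
    intro w hw
    have h2 := h w hw
    simp only [maclaurinCoeff, β.map_zero, iteratedDeriv_zero, pow_zero, mul_one, Nat.factorial_zero,
      Nat.cast_one, div_one, Complex.ofReal_one, one_pow, one_mul, map_mul] at h2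
    rw [h2, ← β.generatingFunction_conj, map_mul, Complex.conj_conj, mul_comm w]
  -- At `w = 0` the identity becomes `ψ 0 = conj (ψ 0)`.
  have h2 := h1 0 (Metric.mem_ball_self one_pos)
  rw [mul_zero, β.generatingFunction_zero, mul_one] at h2
  obtain ⟨c, hc⟩ := Complex.conj_eq_iff_real.1 h2.symm
  rw [hc, Complex.conj_ofReal] at h1
  refine ⟨c, ?_, hc, h1⟩
  rintro rfl
  obtain ⟨z, hz, hne⟩ := hψ_ne
  exact hne (by simpa using h1 z hz)

theorem deriv_comp_mul_left_real (f : ℂ → ℂ) (a z : ℂ) :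
    deriv (fun z => f (a * z)) z = a * deriv f (a * z) := by
  simpa using deriv_comp_mul_left a f z

/-- The first coefficient identity determines `φ`. -/
theorem symbol_eq_of_coeff_one (hφ : DifferentiableOn ℂ φ (Metric.ball 0 1))
    (hφ_self : Set.MapsTo φ (Metric.ball 0 1) (Metric.ball 0 1))
    (hψ : DifferentiableOn ℂ ψ (Metric.ball 0 1)) {c : ℝ} (hc : c ≠ 0)
    (hψc : ∀ z ∈ Metric.ball (0 : ℂ) 1,
      ψ z = c * β.generatingFunction (starRingEnd ℂ (φ 0) * z))
    (h : ∀ w ∈ Metric.ball (0 : ℂ) 1, ψ w * φ w ^ 1 = (β 1 : ℂ) ^ 2 * starRingEnd ℂ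
      (maclaurinCoeff (fun z => ψ z * β.generatingFunction (starRingEnd ℂ w * φ z)) 1)) :
    ∃ a : ℝ, deriv φ 0 = a ∧ ∀ z ∈ Metric.ball (0 : ℂ) 1,
      β.generatingFunction (starRingEnd ℂ (φ 0) * z) * φ z =
        φ 0 * β.generatingFunction (starRingEnd ℂ (φ 0) * z) +
        a * (β 1 : ℂ) ^ 2 * (z * deriv β.generatingFunction (starRingEnd ℂ (φ 0) * z)) := by
  set k := β.generatingFunction with hk
  have hkd : DifferentiableOn ℂ k (Metric.ball 0 1) := β.differentiableOn_generatingFunction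
  have h0 : (0 : ℂ) ∈ Metric.ball (0 : ℂ) 1 := Metric.mem_ball_self one_pos
  have hn0 : Metric.ball (0 : ℂ) 1 ∈ nhds (0 : ℂ) := Metric.ball_mem_nhds _ one_pos
  have hφ0 := hφ_self h0
  have hb := β.ofReal_ne_zero 1
  have hcc : (c : ℂ) ≠ 0 := Complex.ofReal_ne_zero.2 hc
  set a₀ := φ 0 with ha₀
  have hψ0 : ψ 0 = c := by
    rw [hψc 0 h0, mul_zero, hk, β.generatingFunction_zero, mul_one]
  have hψ1 : deriv ψ 0 = c * (starRingEnd ℂ a₀ * (1 / (β 1 : ℂ) ^ 2)) := by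
    have he : ψ =ᶠ[nhds 0] fun z => c * k (starRingEnd ℂ a₀ * z) := by
      filter_upwards [hn0] with z hz using hψc z hz
    rw [he.deriv_eq, deriv_const_mul_field, deriv_comp_mul_left_real, mul_zero, hk,
      β.deriv_generatingFunction_zero]
  -- The first coefficient is `ψ'(0) k(conj w a₀) + ψ(0) k'(conj w a₀) conj w φ'(0)`. Conjugating it
  -- leaves `conj (φ'(0))`, whose reality is proved afterwards.
  have key : ∀ w ∈ Metric.ball (0 : ℂ) 1, k (starRingEnd ℂ a₀ * w) * φ w =
      a₀ * k (starRingEnd ℂ a₀ * w) + starRingEnd ℂ (deriv φ 0) * (β 1 : ℂ) ^ 2 *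
        (w * deriv k (starRingEnd ℂ a₀ * w)) := by
    intro w hw
    have hwa := conj_mul_mem_ball hw hφ0
    have hd : HasDerivAt (fun z => k (starRingEnd ℂ w * φ z))
        (deriv k (starRingEnd ℂ w * a₀) * (starRingEnd ℂ w * deriv φ 0)) 0 :=
      HasDerivAt.comp (h₂ := k) 0
        (hkd.differentiableAt (Metric.isOpen_ball.mem_nhds hwa)).hasDerivAt
        ((hφ.differentiableAt hn0).hasDerivAt.const_mul (starRingEnd ℂ w))
    have h1 := h w hw
    rw [maclaurinCoeff_one, ((hψ.differentiableAt hn0).hasDerivAt.fun_mul hd).deriv, hψ1, hψ0,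
      hψc w hw] at h1
    simp only [map_add, map_mul, map_div₀, map_pow, map_one, Complex.conj_conj,
      Complex.conj_ofReal, hk, ← β.generatingFunction_conj,
      ← β.deriv_generatingFunction_conj] at h1 ⊢
    rw [mul_comm w (starRingEnd ℂ a₀)] at h1
    field_simp at h1
    linear_combination h1
  have hq : DifferentiableAt ℂ (fun z => k (starRingEnd ℂ a₀ * z)) 0 :=
    DifferentiableAt.comp (g := k) 0 (by simpa using hkd.differentiableAt hn0)
      (differentiableAt_id.const_mul _)
  have hq1 : DifferentiableAt ℂ (fun z => deriv k (starRingEnd ℂ a₀ * z)) 0 :=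
    DifferentiableAt.comp (g := deriv k) 0
      (by simpa using (hkd.deriv Metric.isOpen_ball).differentiableAt hn0)
      (differentiableAt_id.const_mul _)
  -- Differentiating `key` at `0`, the terms `|a₀|² k'(0)` on the two sides cancel and `φ'(0) = conj
  -- (φ'(0))` remains.
  have he : (fun w => k (starRingEnd ℂ a₀ * w) * φ w) =ᶠ[nhds 0]
      fun w => a₀ * k (starRingEnd ℂ a₀ * w) + starRingEnd ℂ (deriv φ 0) * (β 1 : ℂ) ^ 2 *
        (w * deriv k (starRingEnd ℂ a₀ * w)) := by
    filter_upwards [hn0] with z hz using key z hz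
  have h2 := he.deriv_eq
  rw [(hq.hasDerivAt.fun_mul (hφ.differentiableAt hn0).hasDerivAt).deriv,
    ((hq.hasDerivAt.const_mul a₀).fun_add
      (((hasDerivAt_id' (0 : ℂ)).fun_mul hq1.hasDerivAt).const_mul _)).deriv, mul_zero, hk,
      β.generatingFunction_zero, β.deriv_generatingFunction_zero] at h2
  rw [← ha₀] at h2
  field_simp at h2
  have h3 : starRingEnd ℂ (deriv φ 0) = deriv φ 0 := by linear_combination -h2
  obtain ⟨a, ha⟩ := Complex.conj_eq_iff_real.1 h3
  refine ⟨a, ha, fun z hz => ?_⟩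
  rw [key z hz, ha, Complex.conj_ofReal]

/-- The second coefficient identity yields a quadratic differential equation for `k`. -/
theorem quadratic_ode_of_coeff_two (hφ : DifferentiableOn ℂ φ (Metric.ball 0 1))
    (hφ_self : Set.MapsTo φ (Metric.ball 0 1) (Metric.ball 0 1))
    (hφ_zero : φ 0 ≠ 0) (hφ_deriv : deriv φ 0 ≠ 0)
    (hψ : DifferentiableOn ℂ ψ (Metric.ball 0 1)) {c a : ℝ} (hc : c ≠ 0)
    (ha : deriv φ 0 = a)
    (hψc : ∀ z ∈ Metric.ball (0 : ℂ) 1,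
      ψ z = c * β.generatingFunction (starRingEnd ℂ (φ 0) * z))
    (hφa : ∀ z ∈ Metric.ball (0 : ℂ) 1,
      β.generatingFunction (starRingEnd ℂ (φ 0) * z) * φ z =
        φ 0 * β.generatingFunction (starRingEnd ℂ (φ 0) * z) +
        a * (β 1 : ℂ) ^ 2 * (z * deriv β.generatingFunction (starRingEnd ℂ (φ 0) * z)))
    (h : ∀ w ∈ Metric.ball (0 : ℂ) 1, ψ w * φ w ^ 2 = (β 2 : ℂ) ^ 2 * starRingEnd ℂ
      (maclaurinCoeff (fun z => ψ z * β.generatingFunction (starRingEnd ℂ w * φ z)) 2)) :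
    ∀ᶠ u in nhds (0 : ℂ), β.generatingFunction u * deriv (deriv β.generatingFunction) u =
      2 * (β 1 : ℂ) ^ 4 / (β 2 : ℂ) ^ 2 * deriv β.generatingFunction u ^ 2 := by
  set k := β.generatingFunction with hk
  have hkd : DifferentiableOn ℂ k (Metric.ball 0 1) := β.differentiableOn_generatingFunction
  have hkd1 : DifferentiableOn ℂ (deriv k) (Metric.ball 0 1) := hkd.deriv Metric.isOpen_ball
  have h0 : (0 : ℂ) ∈ Metric.ball (0 : ℂ) 1 := Metric.mem_ball_self one_pos
  have hn0 : Metric.ball (0 : ℂ) 1 ∈ nhds (0 : ℂ) := Metric.ball_mem_nhds _ one_pos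
  have hφ0 := hφ_self h0
  have hb := β.ofReal_ne_zero 1
  have hb2 := β.ofReal_ne_zero 2
  have hcc : (c : ℂ) ≠ 0 := Complex.ofReal_ne_zero.2 hc
  set a₀ := φ 0 with ha₀
  rw [ha] at hφ_deriv
  have hca : starRingEnd ℂ a₀ ≠ 0 := by simpa using hφ_zero
  have hlin : ∀ b x : ℂ, deriv (fun z : ℂ => b * z) x = b := fun b x => by simp
  have hmaps : ∀ w ∈ Metric.ball (0 : ℂ) 1, Set.MapsTo (fun z => starRingEnd ℂ w * z)
      (Metric.ball (0 : ℂ) 1) (Metric.ball (0 : ℂ) 1) := fun w hw z hz => conj_mul_mem_ball hw hz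
  have hlind : ∀ b : ℂ, DifferentiableOn ℂ (fun z : ℂ => b * z) (Metric.ball 0 1) :=
    fun b => by fun_prop
  have hq : DifferentiableOn ℂ (fun z => k (starRingEnd ℂ a₀ * z)) (Metric.ball 0 1) :=
    hkd.comp (hlind _) (hmaps _ hφ0)
  have hq1 : DifferentiableOn ℂ (fun z => deriv k (starRingEnd ℂ a₀ * z)) (Metric.ball 0 1) :=
    hkd1.comp (hlind _) (hmaps _ hφ0)
  have hqq : deriv (deriv fun z => k (starRingEnd ℂ a₀ * z)) 0 =
      2 / (β 2 : ℂ) ^ 2 * starRingEnd ℂ a₀ ^ 2 := by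
    rw [deriv_deriv_comp_of_isOpen Metric.isOpen_ball Metric.isOpen_ball hkd (hlind _)
      (hmaps _ hφ0) h0]
    simp only [mul_zero]
    rw [funext (hlin (starRingEnd ℂ a₀)), deriv_const, hk, β.deriv_deriv_generatingFunction_zero]
    ring
  have hψ0 : ψ 0 = c := by
    rw [hψc 0 h0, mul_zero, hk, β.generatingFunction_zero, mul_one]
  have heψ : ψ =ᶠ[nhds 0] fun z => c * k (starRingEnd ℂ a₀ * z) := by
    filter_upwards [hn0] with z hz using hψc z hz
  have hψ1 : deriv ψ 0 = c * (starRingEnd ℂ a₀ * (1 / (β 1 : ℂ) ^ 2)) := by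
    rw [heψ.deriv_eq, deriv_const_mul_field, deriv_comp_mul_left_real, mul_zero, hk,
      β.deriv_generatingFunction_zero]
  have hψ2 : deriv (deriv ψ) 0 = c * (2 / (β 2 : ℂ) ^ 2 * starRingEnd ℂ a₀ ^ 2) := by
    rw [heψ.deriv.deriv_eq, deriv_const_mul_field', deriv_const_mul_field, hqq]
  -- Obtained by differentiating `k(conj a₀ w) (φ w - a₀) = a β(1)² w k'(conj a₀ w)` twice at `0`.
  have hφ2 : deriv (deriv φ) 0 =
      2 * a * starRingEnd ℂ a₀ * (2 * (β 1 : ℂ) ^ 2 / (β 2 : ℂ) ^ 2 - 1 / (β 1 : ℂ) ^ 2) := by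
    have he : (fun w => k (starRingEnd ℂ a₀ * w) * (φ w - a₀)) =ᶠ[nhds 0]
        fun w => a * (β 1 : ℂ) ^ 2 * (w * deriv k (starRingEnd ℂ a₀ * w)) := by
      filter_upwards [hn0] with z hz
      linear_combination hφa z hz
    have h2 := he.deriv.deriv_eq
    rw [deriv_const_mul_field', deriv_const_mul_field,
      deriv_deriv_mul_of_isOpen Metric.isOpen_ball hq (hφ.sub_const a₀) h0,
      deriv_deriv_mul_of_isOpen Metric.isOpen_ball (f := fun w => w) differentiableOn_id hq1 h0,
      hqq] at h2
    simp only [deriv_sub_const_fun, deriv_comp_mul_left_real, deriv_id''] at h2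
    rw [mul_zero, hk, β.generatingFunction_zero, β.deriv_generatingFunction_zero,
      β.deriv_deriv_generatingFunction_zero, ha, ← ha₀] at h2
    simp only [deriv_const, sub_self, mul_zero, zero_add, zero_mul, one_mul, add_zero] at h2
    field_simp at h2 ⊢
    linear_combination h2
  -- In the second derivative of `ψ(z) k(conj w φ(z))` at `0`, the part of `φ''(0)` with `1/β(1)²`
  -- cancels the cross term with `ψ'(0) φ'(0)`. This leaves the coefficient `2 a₀ a β(1)²` of `w
  -- k'`.
  have key : ∀ w ∈ Metric.ball (0 : ℂ) 1, k (starRingEnd ℂ a₀ * w) * φ w ^ 2 =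
      a₀ ^ 2 * k (starRingEnd ℂ a₀ * w) +
        2 * a₀ * a * (β 1 : ℂ) ^ 2 * (w * deriv k (starRingEnd ℂ a₀ * w)) +
        a ^ 2 * (β 2 : ℂ) ^ 2 / 2 * (w ^ 2 * deriv (deriv k) (starRingEnd ℂ a₀ * w)) := by
    intro w hw
    have hwφ : DifferentiableOn ℂ (fun z => starRingEnd ℂ w * φ z) (Metric.ball 0 1) :=
      hφ.const_mul _
    have hm : Set.MapsTo (fun z => starRingEnd ℂ w * φ z) (Metric.ball (0 : ℂ) 1)
      (Metric.ball (0 : ℂ) 1) := (hmaps w hw).comp hφ_self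
    have hd : HasDerivAt (fun z => k (starRingEnd ℂ w * φ z))
        (deriv k (starRingEnd ℂ w * a₀) * (starRingEnd ℂ w * deriv φ 0)) 0 :=
      HasDerivAt.comp (h₂ := k) 0
        (hkd.differentiableAt (Metric.isOpen_ball.mem_nhds (hm h0))).hasDerivAt
        ((hφ.differentiableAt hn0).hasDerivAt.const_mul (starRingEnd ℂ w))
    have h1 := h w hw
    rw [maclaurinCoeff_two, deriv_deriv_mul_of_isOpen Metric.isOpen_ball hψ
      (g := fun z => k (starRingEnd ℂ w * φ z)) (hkd.comp hwφ hm) h0, hd.deriv,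
      deriv_deriv_comp_of_isOpen Metric.isOpen_ball Metric.isOpen_ball hkd hwφ hm h0,
      deriv_const_mul_field', deriv_const_mul_field, hψ0, hψ1, hψ2, hφ2, hψc w hw, ha] at h1
    simp only [← ha₀, ha, map_add, map_sub, map_mul, map_div₀, map_pow, map_one, map_ofNat,
      Complex.conj_conj,
      Complex.conj_ofReal, hk, ← β.generatingFunction_conj,
      ← β.deriv_generatingFunction_conj, ← β.deriv_deriv_generatingFunction_conj] at h1 ⊢
    rw [mul_comm w (starRingEnd ℂ a₀)] at h1
    field_simp at h1
    refine mul_left_cancel₀ (pow_ne_zero 2 hb) ?_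
    linear_combination h1 / 2
  -- Multiply `key` by `k` and subtract the square of the formula for `k φ`. Everything cancels
  -- except `a² w² (β(2)²/2 · k k'' - β(1)⁴ k'²) = 0`, and `a` and `w` are nonzero.
  have hode : ∀ w ∈ Metric.ball (0 : ℂ) 1, w ≠ 0 →
      k (starRingEnd ℂ a₀ * w) * deriv (deriv k) (starRingEnd ℂ a₀ * w) =
        2 * (β 1 : ℂ) ^ 4 / (β 2 : ℂ) ^ 2 * deriv k (starRingEnd ℂ a₀ * w) ^ 2 := by
    intro w hw hw0
    have h1 := key w hw
    have h2 := hφa w hw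
    rw [div_mul_eq_mul_div, eq_div_iff (pow_ne_zero 2 hb2)]
    refine mul_left_cancel₀ (mul_ne_zero (pow_ne_zero 2 hφ_deriv) (pow_ne_zero 2 hw0)) ?_
    generalize k (starRingEnd ℂ a₀ * w) = K at *
    generalize deriv k (starRingEnd ℂ a₀ * w) = K₁ at *
    generalize deriv (deriv k) (starRingEnd ℂ a₀ * w) = K₂ at *
    linear_combination (-2 * K) * h1 +
      2 * (K * φ w + a₀ * K + a * (β 1 : ℂ) ^ 2 * (w * K₁)) * h2
  have hr : 0 < ‖starRingEnd ℂ a₀‖ := norm_pos_iff.2 hca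
  filter_upwards [Metric.ball_mem_nhds (0 : ℂ) hr] with u hu
  -- Since `a₀ ≠ 0`, the points `conj a₀ w` fill the disc of radius `|a₀|`. The excluded point `0`
  -- is checked from the explicit Maclaurin coefficients.
  by_cases hu0 : u = 0
  · rw [hu0, hk, β.generatingFunction_zero, β.deriv_generatingFunction_zero,
      β.deriv_deriv_generatingFunction_zero]
    field_simp
  · have h1 := hode (u / starRingEnd ℂ a₀) (by
      rw [mem_ball_zero_iff, norm_div, div_lt_one hr]
      simpa using hu) (div_ne_zero hu0 hca)
    rwa [mul_div_cancel₀ _ hca] at h1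

/-- The alternative in the description of the generating function. -/
theorem WeightSequence.generatingFunction_forms
    (h : ∀ᶠ u in nhds (0 : ℂ), β.generatingFunction u * deriv (deriv β.generatingFunction) u =
      2 * (β 1 : ℂ) ^ 4 / (β 2 : ℂ) ^ 2 * deriv β.generatingFunction u ^ 2) :
    (2 * β 1 ^ 4 / β 2 ^ 2 = 1 ∧
          ∀ z ∈ Metric.ball (0 : ℂ) 1,
            β.generatingFunction z = Complex.exp (z / (β 1 : ℂ) ^ 2)) ∨
        (2 * β 1 ^ 4 / β 2 ^ 2 ≠ 1 ∧
          ∃ l : ℝ, l = 1 / β 1 ^ 2 * (2 * β 1 ^ 4 / β 2 ^ 2 - 1) ∧ 0 < l ∧ l ≤ 1 ∧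
            ∀ z ∈ Metric.ball (0 : ℂ) 1,
              β.generatingFunction z =
                (1 - (l : ℂ) * z) ^ (-(1 / ((l : ℂ) * (β 1 : ℂ) ^ 2)))) := by
  have hb := (β.pos 1).ne'
  have hb1 := β.ofReal_ne_zero 1
  have hb2 := β.ofReal_ne_zero 2
  -- This `l` is the solution of `1 + l β(1)² = 2β(1)⁴/β(2)²`.
  obtain ⟨l, hl⟩ : ∃ l : ℝ, l = 1 / β 1 ^ 2 * (2 * β 1 ^ 4 / β 2 ^ 2 - 1) := ⟨_, rfl⟩
  have hlin := β.linear_ode_of_quadratic_ode (l : ℂ) (by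
    filter_upwards [h] with u hu
    rw [hu, hl]
    push_cast
    congr 1
    field_simp
    ring)
  have hl0 := WeightSequence.nonneg_of_linear_ode hlin
  have hl1 := WeightSequence.le_one_of_linear_ode hlin
  by_cases hcase : 2 * β 1 ^ 4 / β 2 ^ 2 = 1
  · refine Or.inl ⟨hcase, WeightSequence.generatingFunction_eq_exp_of_linear_ode fun u hu => ?_⟩
    have h1 := hlin u hu
    rw [hcase, sub_self, mul_zero] at hl
    simpa [hl] using h1
  · have hlpos : 0 < l := by
      refine lt_of_le_of_ne hl0 fun h => ?_
      rw [hl, eq_comm, mul_eq_zero] at h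
      exact h.elim (one_div_ne_zero (pow_ne_zero 2 hb)) (fun h => hcase (sub_eq_zero.1 h))
    exact Or.inr ⟨hcase, l, hl, hlpos, hl1,
      WeightSequence.generatingFunction_eq_cpow_of_linear_ode hlpos hl1 hlin⟩

end Symbols

/-! ### Boundedness of symmetric operators from the growth of their iterates. -/

section SymmetricOperators

/-- A symmetric operator all of whose iterates have growth at most `Mⁿ` at a vector is bounded by `M`
at that vector. -/
theorem LinearMap.IsSymmetric.norm_apply_le_of_norm_pow_le {V : Type*} [NormedAddCommGroup V]
    [InnerProductSpace ℂ V] {A : V →ₗ[ℂ] V} (hA : A.IsSymmetric) {M D : ℝ} (hM : 0 ≤ M) (f : V)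
    (h : ∀ n, ‖(A ^ n) f‖ ≤ D * M ^ n) : ‖A f‖ ≤ M * ‖f‖ := by
  by_contra! hcon
  have hf : 0 < ‖f‖ := by
    rw [norm_pos_iff]
    rintro rfl
    simp at hcon
  set q := ‖A f‖ / ‖f‖ with hq
  have hqM : M < q := (lt_div_iff₀ hf).2 hcon
  have hq0 : 0 < q := hM.trans_lt hqM
  -- Symmetry and Cauchy–Schwarz make `n ↦ ‖Aⁿ f‖` log-convex. Successive ratios thus never drop
  -- below the first one, `q`, and `q > M` would make the iterates outgrow `D Mⁿ`.
  have hlog : ∀ n, ‖(A ^ (n + 1)) f‖ ^ 2 ≤ ‖(A ^ n) f‖ * ‖(A ^ (n + 2)) f‖ := by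
    intro n
    have h1 : (A ^ (n + 1)) f = A ((A ^ n) f) := by rw [pow_succ', Module.End.mul_apply]
    have h2 : (A ^ (n + 2)) f = A ((A ^ (n + 1)) f) := by rw [pow_succ' A (n + 1), Module.End.mul_apply]
    have h3 : inner ℂ ((A ^ (n + 1)) f) ((A ^ (n + 1)) f) =
        inner ℂ ((A ^ n) f) ((A ^ (n + 2)) f) := by
      conv_lhs => rw [h1]
      rw [hA, ← h1, ← h2]
    rw [← inner_self_eq_norm_sq (𝕜 := ℂ), h3]
    exact re_inner_le_norm _ _
  have hgrow : ∀ n, 0 < ‖(A ^ n) f‖ ∧ q * ‖(A ^ n) f‖ ≤ ‖(A ^ (n + 1)) f‖ := by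
    intro n
    induction n with
    | zero =>
      refine ⟨by simpa using hf, ?_⟩
      simp [hq, hf.ne']
    | succ n ih =>
      have hp : 0 < ‖(A ^ (n + 1)) f‖ := (mul_pos hq0 ih.1).trans_le ih.2
      refine ⟨hp, ?_⟩
      have h1 := hlog n
      refine le_of_mul_le_mul_left ?_ ih.1
      nlinarith [ih.2]
  have hlow : ∀ n, q ^ n * ‖f‖ ≤ ‖(A ^ n) f‖ := by
    intro n
    induction n with
    | zero => simp
    | succ n ih =>
      calc q ^ (n + 1) * ‖f‖ = q * (q ^ n * ‖f‖) := by ring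
        _ ≤ q * ‖(A ^ n) f‖ := by gcongr
        _ ≤ _ := (hgrow n).2
  have hbd : ∀ n, ‖f‖ ≤ D * (M / q) ^ n := by
    intro n
    rw [div_pow, mul_div_assoc', le_div_iff₀ (pow_pos hq0 n), mul_comm]
    exact (hlow n).trans (h n)
  have hlim : Filter.Tendsto (fun n => D * (M / q) ^ n) Filter.atTop (nhds (D * 0)) :=
    (tendsto_pow_atTop_nhds_zero_of_lt_one (by positivity)
      ((div_lt_one hq0).2 hqM)).const_mul D
  have := ge_of_tendsto' hlim hbd
  rw [mul_zero] at this
  exact absurd hf (not_lt.2 this)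

/-- A symmetric operator on the span of a total family that permutes the lines of the family with
uniformly bounded stretching extends to a bounded self-adjoint operator. -/
theorem exists_isSelfAdjoint_extension {H ι : Type*} [NormedAddCommGroup H] [InnerProductSpace ℂ H]
    [CompleteSpace H] (e : ι → H) (hd : Dense (Submodule.span ℂ (Set.range e) : Set H))
    (A : Submodule.span ℂ (Set.range e) →ₗ[ℂ] Submodule.span ℂ (Set.range e))
    (hA : A.IsSymmetric) (s : ι → ℂ) (t : ι → ι) {M : ℝ} (hM : 0 ≤ M)
    (hs : ∀ i, A ⟨e i, Submodule.subset_span ⟨i, rfl⟩⟩ =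
      s i • ⟨e (t i), Submodule.subset_span ⟨t i, rfl⟩⟩)
    (hsM : ∀ i, ‖s i‖ * ‖e (t i)‖ ≤ M * ‖e i‖) :
    ∃ W : H →L[ℂ] H, IsSelfAdjoint W ∧ ∀ f : Submodule.span ℂ (Set.range e), W f = A f := by
  have hgen : ∀ n i, ‖(A ^ n) ⟨e i, Submodule.subset_span ⟨i, rfl⟩⟩‖ ≤ ‖e i‖ * M ^ n := by
    intro n
    induction n with
    | zero => intro i; simp
    | succ n ih =>
      intro i
      rw [pow_succ, Module.End.mul_apply, hs, map_smul, norm_smul]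
      calc _ ≤ ‖s i‖ * (‖e (t i)‖ * M ^ n) := by gcongr; exact ih _
        _ = (‖s i‖ * ‖e (t i)‖) * M ^ n := by ring
        _ ≤ (M * ‖e i‖) * M ^ n := mul_le_mul_of_nonneg_right (hsM i) (pow_nonneg hM n)
        _ = _ := by ring
  -- The constant `D` depends on `f`, but the rate `M` does not. Only the rate survives in the norm
  -- bound, which is therefore uniform on the span.
  have hgrow : ∀ f, ∃ D : ℝ, ∀ n, ‖(A ^ n) f‖ ≤ D * M ^ n := by
    rintro ⟨f, hf⟩
    induction hf using Submodule.span_induction with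
    | mem x hx =>
      obtain ⟨i, rfl⟩ := hx
      exact ⟨_, fun n => hgen n i⟩
    | zero => exact ⟨0, fun n => by simp [show (⟨0, _⟩ : Submodule.span ℂ (Set.range e)) = 0 from rfl]⟩
    | add x y hx hy h1 h2 =>
      obtain ⟨D₁, h1⟩ := h1
      obtain ⟨D₂, h2⟩ := h2
      refine ⟨D₁ + D₂, fun n => ?_⟩
      rw [show (⟨x + y, _⟩ : Submodule.span ℂ (Set.range e)) = ⟨x, hx⟩ + ⟨y, hy⟩ from rfl, map_add,
        add_mul]
      exact (norm_add_le _ _).trans (add_le_add (h1 n) (h2 n))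
    | smul c x hx h1 =>
      obtain ⟨D, h1⟩ := h1
      refine ⟨‖c‖ * D, fun n => ?_⟩
      rw [show (⟨c • x, _⟩ : Submodule.span ℂ (Set.range e)) = c • ⟨x, hx⟩ from rfl, map_smul,
        norm_smul, mul_assoc]
      gcongr
      exact h1 n
  set B := A.mkContinuous M fun f => by
    obtain ⟨D, h⟩ := hgrow f
    exact hA.norm_apply_le_of_norm_pow_le hM f h with hB
  set j := (Submodule.span ℂ (Set.range e)).subtypeL with hj
  have hdr : DenseRange j := by
    rw [DenseRange, show Set.range j = (Submodule.span ℂ (Set.range e) : Set H) from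
      Subtype.range_coe]
    exact hd
  have hW : ∀ f : Submodule.span ℂ (Set.range e), (j.comp B).extend j f = A f := fun f =>
    ContinuousLinearMap.extend_eq (j.comp B) hdr isUniformEmbedding_subtype_val.isUniformInducing f
  refine ⟨(j.comp B).extend j, ?_, hW⟩
  rw [ContinuousLinearMap.isSelfAdjoint_iff_isSymmetric]
  intro x y
  refine hdr.induction_on₂ (p := fun x y => inner ℂ ((j.comp B).extend j x) y =
    inner ℂ x ((j.comp B).extend j y)) ?_ ?_ x y
  · exact isClosed_eq (by fun_prop) (by fun_prop)
  · intro f g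
    change inner ℂ ((j.comp B).extend j f) (g : H) = inner ℂ (f : H) ((j.comp B).extend j g)
    rw [hW, hW]
    exact hA f g

end SymmetricOperators

/-! ### Boundary behaviour of a selfmap of the disc. -/

/-- A consequence of the Schwarz–Pick lemma. -/
theorem exists_one_sub_norm_sq_ge {φ : ℂ → ℂ} (hφ : DifferentiableOn ℂ φ (Metric.ball 0 1))
    (hφ_self : Set.MapsTo φ (Metric.ball 0 1) (Metric.ball 0 1)) :
    ∃ δ : ℝ, 0 < δ ∧ δ ≤ 1 ∧ ∀ w ∈ Metric.ball (0 : ℂ) 1,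
      δ * (1 - ‖w‖ ^ 2) ≤ 1 - ‖φ w‖ ^ 2 := by
  set a := φ 0 with ha
  have ha1 : ‖a‖ < 1 := by simpa using hφ_self (Metric.mem_ball_self one_pos)
  have hden : ∀ w ∈ Metric.ball (0 : ℂ) 1, 1 - ‖a‖ ≤ ‖1 - starRingEnd ℂ a * φ w‖ := by
    intro w hw
    have h1 : ‖φ w‖ < 1 := by simpa using hφ_self hw
    have h2 := norm_sub_norm_le 1 (starRingEnd ℂ a * φ w)
    rw [norm_one, norm_mul, RCLike.norm_conj] at h2
    nlinarith [norm_nonneg a]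
  have hid : ∀ w, ‖1 - starRingEnd ℂ a * φ w‖ ^ 2 - ‖φ w - a‖ ^ 2 =
      (1 - ‖a‖ ^ 2) * (1 - ‖φ w‖ ^ 2) := by
    intro w
    simp only [Complex.sq_norm, Complex.normSq_apply, Complex.sub_re, Complex.sub_im,
      Complex.mul_re, Complex.mul_im, Complex.conj_re, Complex.conj_im, Complex.one_re,
      Complex.one_im]
    ring
  have hne : ∀ w ∈ Metric.ball (0 : ℂ) 1, 1 - starRingEnd ℂ a * φ w ≠ 0 := by
    intro w hw h
    have := hden w hw
    rw [h, norm_zero] at this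
    linarith
  have hlt : ∀ w ∈ Metric.ball (0 : ℂ) 1, ‖φ w‖ ^ 2 < 1 := by
    intro w hw
    have h1 : ‖φ w‖ < 1 := by simpa using hφ_self hw
    nlinarith [norm_nonneg (φ w)]
  have ha2 : ‖a‖ ^ 2 < 1 := by nlinarith [norm_nonneg a]
  -- The Schwarz lemma applies after moving `φ 0` to the origin by a disc automorphism; `hid` shows
  -- that the composite stays in the disc.
  have hschwarz : ∀ w ∈ Metric.ball (0 : ℂ) 1,
      ‖(φ w - a) / (1 - starRingEnd ℂ a * φ w)‖ ≤ ‖w‖ := by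
    intro w hw
    refine Complex.norm_le_norm_of_mapsTo_ball
      (f := fun w => (φ w - a) / (1 - starRingEnd ℂ a * φ w)) (R := 1) ?_ ?_ ?_ ?_
    · exact (hφ.sub_const a).div ((hφ.const_mul _).const_sub 1) hne
    · intro w hw
      rw [mem_closedBall_zero_iff, norm_div, div_le_one (norm_pos_iff.2 (hne w hw))]
      refine le_of_sq_le_sq ?_ (norm_nonneg _)
      nlinarith [hid w, hlt w hw]
    · simp [ha]
    · simpa using hw
  -- The constant is the square of the lower bound `hden` for the denominator.
  refine ⟨(1 - ‖a‖) ^ 2, by nlinarith, by nlinarith [norm_nonneg a], fun w hw => ?_⟩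
  have h1 := hschwarz w hw
  rw [norm_div, div_le_iff₀ (norm_pos_iff.2 (hne w hw))] at h1
  have h2 : ‖φ w - a‖ ^ 2 ≤ ‖w‖ ^ 2 * ‖1 - starRingEnd ℂ a * φ w‖ ^ 2 := by
    rw [← mul_pow]
    exact pow_le_pow_left₀ (norm_nonneg _) h1 2
  have h3 : (1 - ‖a‖) ^ 2 ≤ ‖1 - starRingEnd ℂ a * φ w‖ ^ 2 :=
    pow_le_pow_left₀ (by linarith) (hden w hw) 2
  have hw1 : ‖w‖ ^ 2 < 1 := by
    have : ‖w‖ < 1 := by simpa using hw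
    nlinarith [norm_nonneg w]
  have h4 := hlt w hw
  have h5 := hid w
  calc (1 - ‖a‖) ^ 2 * (1 - ‖w‖ ^ 2) ≤ ‖1 - starRingEnd ℂ a * φ w‖ ^ 2 * (1 - ‖w‖ ^ 2) := by
        gcongr
    _ ≤ (1 - ‖a‖ ^ 2) * (1 - ‖φ w‖ ^ 2) := by linarith
    _ ≤ 1 * (1 - ‖φ w‖ ^ 2) := by
        gcongr
        linarith [sq_nonneg ‖a‖]
    _ = _ := one_mul _

/-! ### Construction of the operator from its action on kernels. -/

namespace WeightedHardy

variable {β : WeightSequence} {φ ψ : ℂ → ℂ}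

/-- A weighted composition operator whose action on reproducing kernels is Hermitian is bounded,
provided that `ψ` is bounded and `φ` does not increase the norms of the kernels too much. -/
theorem exists_isSelfAdjoint_isWeightedComposition
    (hφ_self : Set.MapsTo φ (Metric.ball 0 1) (Metric.ball 0 1))
    (hherm : ∀ w ∈ Metric.ball (0 : ℂ) 1, ∀ z ∈ Metric.ball (0 : ℂ) 1,
      ψ z * β.generatingFunction (starRingEnd ℂ w * φ z) =
        starRingEnd ℂ (ψ w) * β.generatingFunction (starRingEnd ℂ (φ w) * z))
    {B C : ℝ} (hC : 0 ≤ C) (hψB : ∀ z ∈ Metric.ball (0 : ℂ) 1, ‖ψ z‖ ≤ B)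
    (hφC : ∀ w ∈ Metric.ball (0 : ℂ) 1, (β.generatingFunction ((‖φ w‖ ^ 2 : ℝ) : ℂ)).re ≤
      C * (β.generatingFunction ((‖w‖ ^ 2 : ℝ) : ℂ)).re) :
    ∃ W : WeightedHardy β →L[ℂ] WeightedHardy β, IsWeightedComposition ψ φ W ∧ IsSelfAdjoint W := by
  set V := Submodule.span ℂ (Set.range (kernel β)) with hV
  -- By `hherm`, `f ↦ ψ · (f ∘ φ)` sends `K_w` to `conj (ψ w) K_{φ w}` and hence preserves the span.
  -- Defining it by its pointwise formula avoids a choice of representation as a combination of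
  -- kernels.
  have hex : ∀ f : V, ∃ g : V, ∀ z ∈ Metric.ball (0 : ℂ) 1,
      (g : WeightedHardy β) z = ψ z * (f : WeightedHardy β) (φ z) := by
    rintro ⟨f, hf⟩
    induction hf using Submodule.span_induction with
    | mem x hx =>
      obtain ⟨w, rfl⟩ := hx
      refine ⟨starRingEnd ℂ (ψ w) • ⟨kernel β ⟨φ w, hφ_self w.2⟩,
        Submodule.subset_span ⟨_, rfl⟩⟩, fun z hz => ?_⟩
      rw [Submodule.coe_smul, smul_apply, kernel_apply _ hz, kernel_apply _ (hφ_self hz)]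
      exact (hherm w w.2 z hz).symm
    | zero => exact ⟨0, fun z hz => by simp [zero_apply]⟩
    | add x y hx hy h1 h2 =>
      obtain ⟨g₁, h1⟩ := h1
      obtain ⟨g₂, h2⟩ := h2
      refine ⟨g₁ + g₂, fun z hz => ?_⟩
      rw [Submodule.coe_add, add_apply, h1 z hz, h2 z hz, add_apply, mul_add]
    | smul c x hx h1 =>
      obtain ⟨g, h1⟩ := h1
      refine ⟨c • g, fun z hz => ?_⟩
      rw [Submodule.coe_smul, smul_apply, h1 z hz, smul_apply]
      ring
  choose T hT using hex
  have hext : ∀ f g : V, (∀ z ∈ Metric.ball (0 : ℂ) 1,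
      (f : WeightedHardy β) z = (g : WeightedHardy β) z) → f = g :=
    fun f g h => Subtype.ext (ext_ball h)
  let A : V →ₗ[ℂ] V :=
    { toFun := T
      map_add' := fun f g => hext _ _ fun z hz => by
        rw [hT _ z hz, Submodule.coe_add, Submodule.coe_add, add_apply, add_apply, hT _ z hz,
          hT _ z hz, mul_add]
      map_smul' := fun c f => hext _ _ fun z hz => by
        rw [hT _ z hz, RingHom.id_apply, Submodule.coe_smul, Submodule.coe_smul, smul_apply,
          smul_apply, hT _ z hz]
        ring }
  have hAK : ∀ w : Metric.ball (0 : ℂ) 1, A ⟨kernel β w, Submodule.subset_span ⟨w, rfl⟩⟩ =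
      starRingEnd ℂ (ψ w) • ⟨kernel β ⟨φ w, hφ_self w.2⟩,
        Submodule.subset_span ⟨⟨φ w, hφ_self w.2⟩, rfl⟩⟩ := by
    intro w
    refine hext _ _ fun z hz => ?_
    rw [Submodule.coe_smul, smul_apply, kernel_apply _ hz]
    refine (hT _ z hz).trans ?_
    rw [kernel_apply _ (hφ_self hz)]
    exact hherm w w.2 z hz
  have hsymm : A.IsSymmetric := by
    -- By the reproducing property, both sides equal `ψ(w) g(φ w)`.
    have h1 : ∀ (w : Metric.ball (0 : ℂ) 1) (g : V),
        inner ℂ (A ⟨kernel β w, Submodule.subset_span ⟨w, rfl⟩⟩) g =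
          inner ℂ (⟨kernel β w, Submodule.subset_span ⟨w, rfl⟩⟩ : V) (A g) := by
      intro w g
      rw [hAK]
      refine (inner_smul_left (𝕜 := ℂ) (E := V) _ _ _).trans ?_
      rw [Complex.conj_conj, Submodule.coe_inner, Submodule.coe_inner, inner_kernel, inner_kernel]
      exact (hT g w w.2).symm
    rintro ⟨f, hf⟩ g
    induction hf using Submodule.span_induction with
    | mem x hx =>
      obtain ⟨w, rfl⟩ := hx
      exact h1 w g
    | zero =>
      rw [show (⟨0, _⟩ : V) = 0 from rfl, map_zero, inner_zero_left, inner_zero_left]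
    | add x y hx hy h1 h2 =>
      rw [show (⟨x + y, _⟩ : V) = ⟨x, hx⟩ + ⟨y, hy⟩ from rfl, map_add, inner_add_left,
        inner_add_left, h1, h2]
    | smul c x hx h1 =>
      rw [show (⟨c • x, _⟩ : V) = c • ⟨x, hx⟩ from rfl, map_smul]
      refine (inner_smul_left (𝕜 := ℂ) (E := V) _ _ _).trans ?_
      rw [h1]
      exact (inner_smul_left (𝕜 := ℂ) (E := V) _ _ _).symm
  have hB : 0 ≤ B := (norm_nonneg _).trans (hψB 0 (Metric.mem_ball_self one_pos))
  obtain ⟨W, hWsa, hW⟩ := exists_isSelfAdjoint_extension (kernel β) span_kernel_dense A hsymm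
    (fun w => starRingEnd ℂ (ψ w)) (fun w => ⟨φ w, hφ_self w.2⟩)
    (M := B * √C) (by positivity) hAK fun w => by
      rw [RCLike.norm_conj, mul_assoc]
      refine mul_le_mul (hψB w w.2) ?_ (norm_nonneg _) hB
      refine le_of_sq_le_sq ?_ (by positivity)
      rw [mul_pow, Real.sq_sqrt hC, norm_kernel_sq, norm_kernel_sq]
      exact hφC w w.2
  refine ⟨W, fun f z hz => ?_, hWsa⟩
  -- Point evaluations are inner products with kernels, hence continuous, so the formula for `W`
  -- passes from the dense span to the whole space.
  have hclosed : IsClosed {f : WeightedHardy β | W f z = ψ z * f (φ z)} := by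
    simp_rw [← inner_kernel ⟨z, hz⟩, ← inner_kernel ⟨φ z, hφ_self hz⟩]
    exact isClosed_eq (by fun_prop) (by fun_prop)
  refine hclosed.closure_subset_iff.2 ?_ (span_kernel_dense f)
  intro g hg
  have h1 := hW ⟨g, hg⟩
  change W g = _ at h1
  change W g z = _
  rw [h1]
  exact hT ⟨g, hg⟩ z hz

end WeightedHardy

/-! ### Admissible generating functions and the implication (iii) → (i). -/

/-- Both factors lie in the right half-plane, so their arguments add up to less than `π` in absolute
value and the principal logarithms add. -/
theorem one_sub_mul_cpow_mul {l : ℝ} (h0 : 0 ≤ l) (h1 : l ≤ 1) {u v : ℂ}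
    (hu : u ∈ Metric.ball (0 : ℂ) 1) (hv : v ∈ Metric.ball (0 : ℂ) 1) (p : ℂ) :
    (1 - (l : ℂ) * u) ^ p * (1 - (l : ℂ) * v) ^ p =
      ((1 - (l : ℂ) * u) * (1 - (l : ℂ) * v)) ^ p := by
  have hu0 := one_sub_mul_ne_zero h0 h1 hu
  have hv0 := one_sub_mul_ne_zero h0 h1 hv
  have hua := abs_lt.1 (Complex.abs_arg_lt_pi_div_two_iff.2 (Or.inl (re_one_sub_mul_pos h0 h1 hu)))
  have hva := abs_lt.1 (Complex.abs_arg_lt_pi_div_two_iff.2 (Or.inl (re_one_sub_mul_pos h0 h1 hv)))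
  rw [Complex.cpow_def_of_ne_zero hu0, Complex.cpow_def_of_ne_zero hv0,
    Complex.cpow_def_of_ne_zero (mul_ne_zero hu0 hv0), ← Complex.exp_add, ← add_mul,
    Complex.log_mul hu0 hv0 ⟨by linarith [hua.1, hva.1], by linarith [hua.2, hva.2]⟩]

namespace WeightSequence

variable {β : WeightSequence}

/-- The properties of the admissible generating functions on which the boundedness of the
weighted composition operators rests. -/
structure IsAdmissible (β : WeightSequence) (l : ℝ) : Prop where
  nonneg : 0 ≤ l
  le_one : l ≤ 1
  ne_zero : ∀ u ∈ Metric.ball (0 : ℂ) 1, β.generatingFunction u ≠ 0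
  linear_ode : ∀ u ∈ Metric.ball (0 : ℂ) 1, (1 - (l : ℂ) * u) * deriv β.generatingFunction u =
    1 / (β 1 : ℂ) ^ 2 * β.generatingFunction u
  -- For the powers this reflects `(1 - lu)(1 - lv) = 1 - l(u + v - luv)`; for `l = 0` it is the
  -- addition law of the exponential.
  mul_eq_mul : ∀ u ∈ Metric.ball (0 : ℂ) 1, ∀ v ∈ Metric.ball (0 : ℂ) 1,
    ∀ u' ∈ Metric.ball (0 : ℂ) 1, ∀ v' ∈ Metric.ball (0 : ℂ) 1,
    u + v - (l : ℂ) * u * v = u' + v' - (l : ℂ) * u' * v' →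
      β.generatingFunction u * β.generatingFunction v =
        β.generatingFunction u' * β.generatingFunction v'
  -- To be used with `x = |φ w|²`, `y = |w|²` and the Schwarz–Pick constant `δ`, to compare kernel
  -- norms.
  growth : ∀ δ : ℝ, 0 < δ → δ ≤ 1 → ∃ C : ℝ, 0 ≤ C ∧ ∀ x y : ℝ, 0 ≤ x → x < 1 → 0 ≤ y → y < 1 →
    δ * (1 - y) ≤ 1 - x →
      (β.generatingFunction (x : ℂ)).re ≤ C * (β.generatingFunction (y : ℂ)).re

theorem ofReal_mem_ball {x : ℝ} (h0 : 0 ≤ x) (h1 : x < 1) : (x : ℂ) ∈ Metric.ball (0 : ℂ) 1 := by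
  simpa [abs_of_nonneg h0] using h1

theorem isAdmissible_of_exp (h : ∀ z ∈ Metric.ball (0 : ℂ) 1,
    β.generatingFunction z = Complex.exp (z / (β 1 : ℂ) ^ 2)) : β.IsAdmissible 0 where
  nonneg := le_rfl
  le_one := zero_le_one
  ne_zero u hu := by
    rw [h u hu]
    exact Complex.exp_ne_zero _
  linear_ode u hu := by
    have he : β.generatingFunction =ᶠ[nhds u] fun z => Complex.exp (z / (β 1 : ℂ) ^ 2) := by
      filter_upwards [Metric.isOpen_ball.mem_nhds hu] with z hz using h z hz
    rw [he.deriv_eq, h u hu, (((hasDerivAt_id' u).div_const _).cexp).deriv]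
    simp
    ring
  mul_eq_mul u hu v hv u' hu' v' hv' he := by
    rw [h u hu, h v hv, h u' hu', h v' hv', ← Complex.exp_add, ← Complex.exp_add, ← add_div,
      ← add_div]
    congr 2
    simpa using he
  growth δ _ _ := by
    refine ⟨Real.exp (1 / β 1 ^ 2), (Real.exp_pos _).le, fun x y hx hx1 hy hy1 _ => ?_⟩
    have h1 : (β.generatingFunction (x : ℂ)).re ≤ Real.exp (1 / β 1 ^ 2) := by
      rw [h _ (ofReal_mem_ball hx hx1), ← Complex.ofReal_pow, ← Complex.ofReal_div,
        Complex.exp_ofReal_re]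
      gcongr
    exact h1.trans (le_mul_of_one_le_right (Real.exp_pos _).le
      (β.one_le_re_generatingFunction hy hy1))

theorem isAdmissible_of_cpow {l : ℝ} (h0 : 0 < l) (h1 : l ≤ 1)
    (h : ∀ z ∈ Metric.ball (0 : ℂ) 1, β.generatingFunction z =
      (1 - (l : ℂ) * z) ^ (-(1 / ((l : ℂ) * (β 1 : ℂ) ^ 2)))) : β.IsAdmissible l where
  nonneg := h0.le
  le_one := h1
  ne_zero u hu := by
    rw [h u hu, Complex.cpow_ne_zero_iff]
    exact Or.inl (one_sub_mul_ne_zero h0.le h1 hu)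
  linear_ode u hu := by
    have hlc : (l : ℂ) ≠ 0 := Complex.ofReal_ne_zero.2 h0.ne'
    have hb := β.ofReal_ne_zero 1
    have hne := one_sub_mul_ne_zero h0.le h1 hu
    have he : β.generatingFunction =ᶠ[nhds u]
        fun z => (1 - (l : ℂ) * z) ^ (-(1 / ((l : ℂ) * (β 1 : ℂ) ^ 2))) := by
      filter_upwards [Metric.isOpen_ball.mem_nhds hu] with z hz using h z hz
    rw [he.deriv_eq, h u hu, (hasDerivAt_one_sub_mul_cpow h0.le h1 hu _).deriv]
    field_simp
  mul_eq_mul u hu v hv u' hu' v' hv' he := by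
    rw [h u hu, h v hv, h u' hu', h v' hv', one_sub_mul_cpow_mul h0.le h1 hu hv,
      one_sub_mul_cpow_mul h0.le h1 hu' hv']
    congr 1
    linear_combination (-(l : ℂ)) * he
  growth δ hδ hδ1 := by
    have hre : ∀ x : ℝ, 0 ≤ x → x < 1 → 0 < 1 - l * x ∧ (β.generatingFunction (x : ℂ)).re =
        (1 - l * x) ^ (-(1 / (l * β 1 ^ 2))) := by
      intro x hx hx1
      have hpos : 0 < 1 - l * x := by nlinarith
      refine ⟨hpos, ?_⟩
      rw [h _ (ofReal_mem_ball hx hx1), ← Complex.ofReal_re ((1 - l * x) ^ _),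
        Complex.ofReal_cpow hpos.le]
      push_cast
      rfl
    have hp : -(1 / (l * β 1 ^ 2)) ≤ 0 := by
      have := β.pos 1
      rw [neg_nonpos]
      positivity
    -- As `δ ≤ 1`, `1 - lx = (1 - l) + l(1 - x) ≥ δ(1 - l) + lδ(1 - y) = δ(1 - ly)`, and the
    -- exponent is nonpositive.
    refine ⟨δ ^ (-(1 / (l * β 1 ^ 2))), by positivity, fun x y hx hx1 hy hy1 hxy => ?_⟩
    obtain ⟨hxp, hx2⟩ := hre x hx hx1
    obtain ⟨hyp, hy2⟩ := hre y hy hy1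
    rw [hx2, hy2, ← Real.mul_rpow hδ.le hyp.le]
    exact Real.rpow_le_rpow_of_nonpos (mul_pos hδ hyp) (by nlinarith) hp

namespace IsAdmissible

variable {l : ℝ} {φ ψ : ℂ → ℂ} {c a : ℝ}

/-- The equation gives `k'/k = 1/(β(1)² (1 - lu))`, so `φ` is linear fractional, and affine when `l
= 0`. -/
theorem symbol_eq (h : β.IsAdmissible l) {z : ℂ}
    (hz : starRingEnd ℂ (φ 0) * z ∈ Metric.ball (0 : ℂ) 1)
    (hφa : φ z = φ 0 + (a : ℂ) * (β 1 : ℂ) ^ 2 * z *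
      (deriv β.generatingFunction (starRingEnd ℂ (φ 0) * z) /
        β.generatingFunction (starRingEnd ℂ (φ 0) * z))) :
    (φ z - φ 0) * (1 - (l : ℂ) * (starRingEnd ℂ (φ 0) * z)) = a * z := by
  have h1 := h.linear_ode _ hz
  have h2 := h.ne_zero _ hz
  have hb := β.ofReal_ne_zero 1
  rw [hφa]
  generalize starRingEnd ℂ (φ 0) * z = u at *
  field_simp at h1 ⊢
  linear_combination a * z * h1

/-- The operator with the admissible symbols acts on reproducing kernels in a Hermitian way. -/
theorem hermitian_on_kernels (h : β.IsAdmissible l)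
    (hφ_self : Set.MapsTo φ (Metric.ball 0 1) (Metric.ball 0 1))
    (hψc : ∀ z ∈ Metric.ball (0 : ℂ) 1,
      ψ z = c * β.generatingFunction (starRingEnd ℂ (φ 0) * z))
    (hφa : ∀ z ∈ Metric.ball (0 : ℂ) 1, φ z = φ 0 + (a : ℂ) * (β 1 : ℂ) ^ 2 * z *
      (deriv β.generatingFunction (starRingEnd ℂ (φ 0) * z) /
        β.generatingFunction (starRingEnd ℂ (φ 0) * z)))
    {w z : ℂ} (hw : w ∈ Metric.ball (0 : ℂ) 1) (hz : z ∈ Metric.ball (0 : ℂ) 1) :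
    ψ z * β.generatingFunction (starRingEnd ℂ w * φ z) =
      starRingEnd ℂ (ψ w) * β.generatingFunction (starRingEnd ℂ (φ w) * z) := by
  have hφ0 := hφ_self (Metric.mem_ball_self one_pos)
  have hz0 := conj_mul_mem_ball hφ0 hz
  have hw0 := conj_mul_mem_ball hw hφ0
  have e1 := h.symbol_eq hz0 (hφa z hz)
  have e2 := congrArg (starRingEnd ℂ) (h.symbol_eq (conj_mul_mem_ball hφ0 hw) (hφa w hw))
  simp only [map_mul, map_sub, map_one, Complex.conj_conj, Complex.conj_ofReal] at e2
  -- The two expressions `u + v - luv` agree because `conj w * e1` and `z * e2` have the same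
  -- right-hand side `a conj w z`; this uses that `a` is real.
  have h1 := h.mul_eq_mul _ hz0 _ (conj_mul_mem_ball hw (hφ_self hz)) _ hw0 _
    (conj_mul_mem_ball (hφ_self hw) hz) (by linear_combination starRingEnd ℂ w * e1 - z * e2)
  rw [hψc z hz, hψc w hw, map_mul, Complex.conj_ofReal, ← β.generatingFunction_conj, map_mul,
    Complex.conj_conj, mul_assoc, h1, mul_comm (φ 0), mul_assoc]

theorem exists_isWeightedComposition (h : β.IsAdmissible l)
    (hφ : DifferentiableOn ℂ φ (Metric.ball 0 1))
    (hφ_self : Set.MapsTo φ (Metric.ball 0 1) (Metric.ball 0 1))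
    (hψc : ∀ z ∈ Metric.ball (0 : ℂ) 1,
      ψ z = c * β.generatingFunction (starRingEnd ℂ (φ 0) * z))
    (hφa : ∀ z ∈ Metric.ball (0 : ℂ) 1, φ z = φ 0 + (a : ℂ) * (β 1 : ℂ) ^ 2 * z *
      (deriv β.generatingFunction (starRingEnd ℂ (φ 0) * z) /
        β.generatingFunction (starRingEnd ℂ (φ 0) * z))) :
    ∃ W : WeightedHardy β →L[ℂ] WeightedHardy β,
      WeightedHardy.IsWeightedComposition ψ φ W ∧ IsSelfAdjoint W := by
  have hφ0 : ‖φ 0‖ < 1 := by simpa using hφ_self (Metric.mem_ball_self one_pos)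
  obtain ⟨δ, hδ, hδ1, hpick⟩ := exists_one_sub_norm_sq_ge hφ hφ_self
  obtain ⟨C, hC, hgrowth⟩ := h.growth δ hδ hδ1
  have hsub : Metric.closedBall (0 : ℂ) ‖φ 0‖ ⊆ Metric.ball 0 1 :=
    Metric.closedBall_subset_ball hφ0
  obtain ⟨B, hB⟩ := (isCompact_closedBall (0 : ℂ) ‖φ 0‖).exists_bound_of_continuousOn
    (β.differentiableOn_generatingFunction.continuousOn.mono hsub)
  have hsq : ∀ w ∈ Metric.ball (0 : ℂ) 1, ‖w‖ ^ 2 < 1 := fun w hw =>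
    pow_lt_one₀ (norm_nonneg _) (by simpa using hw) two_ne_zero
  -- `ψ` is bounded because `conj (φ 0) * z` stays in the compact disc of radius `|φ 0| < 1`, on
  -- which `k` is bounded.
  refine WeightedHardy.exists_isSelfAdjoint_isWeightedComposition hφ_self
    (fun w hw z hz => h.hermitian_on_kernels hφ_self hψc hφa hw hz) (B := ‖(c : ℂ)‖ * B) hC
    (fun z hz => ?_) (fun w hw => ?_)
  · rw [hψc z hz, norm_mul]
    refine mul_le_mul_of_nonneg_left (hB _ ?_) (norm_nonneg _)
    rw [mem_closedBall_zero_iff, norm_mul, RCLike.norm_conj]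
    exact mul_le_of_le_one_right (norm_nonneg _) (mem_ball_zero_iff.1 hz).le
  · exact hgrowth _ _ (sq_nonneg _) (hsq _ (hφ_self hw)) (sq_nonneg _) (hsq w hw) (hpick w hw)

end IsAdmissible

theorem exists_isAdmissible
    (h : (2 * β 1 ^ 4 / β 2 ^ 2 = 1 ∧
          ∀ z ∈ Metric.ball (0 : ℂ) 1,
            β.generatingFunction z = Complex.exp (z / (β 1 : ℂ) ^ 2)) ∨
        (2 * β 1 ^ 4 / β 2 ^ 2 ≠ 1 ∧
          ∃ l : ℝ, l = 1 / β 1 ^ 2 * (2 * β 1 ^ 4 / β 2 ^ 2 - 1) ∧ 0 < l ∧ l ≤ 1 ∧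
            ∀ z ∈ Metric.ball (0 : ℂ) 1,
              β.generatingFunction z =
                (1 - (l : ℂ) * z) ^ (-(1 / ((l : ℂ) * (β 1 : ℂ) ^ 2))))) :
    ∃ l, β.IsAdmissible l := by
  rcases h with ⟨_, h⟩ | ⟨_, l, _, h0, h1, h⟩
  · exact ⟨0, isAdmissible_of_exp h⟩
  · exact ⟨l, isAdmissible_of_cpow h0 h1 h⟩

end WeightSequence

/-! ### The equivalence. -/

theorem theorem2 (β : WeightSequence) (φ ψ : ℂ → ℂ)
    (hφ : DifferentiableOn ℂ φ (Metric.ball 0 1))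
    (hφ_self : Set.MapsTo φ (Metric.ball 0 1) (Metric.ball 0 1))
    (hφ_zero : φ 0 ≠ 0) (hφ_deriv : deriv φ 0 ≠ 0)
    (hψ : DifferentiableOn ℂ ψ (Metric.ball 0 1))
    (hψ_ne : ∃ z ∈ Metric.ball (0 : ℂ) 1, ψ z ≠ 0) :
    List.TFAE [
      -- (i)
      ∃ W : WeightedHardy β →L[ℂ] WeightedHardy β,
        WeightedHardy.IsWeightedComposition ψ φ W ∧ IsSelfAdjoint W,
      -- (ii)
      ∃ W : WeightedHardy β →L[ℂ] WeightedHardy β,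
        WeightedHardy.IsWeightedComposition ψ φ W ∧
        ContinuousLinearMap.adjoint W (WeightedHardy.monomial β 0) =
          W (WeightedHardy.monomial β 0) ∧
        ContinuousLinearMap.adjoint W (WeightedHardy.monomial β 1) =
          W (WeightedHardy.monomial β 1) ∧
        ContinuousLinearMap.adjoint W (WeightedHardy.monomial β 2) =
          W (WeightedHardy.monomial β 2),
      -- (iii)
      ((2 * β 1 ^ 4 / β 2 ^ 2 = 1 ∧
          ∀ z ∈ Metric.ball (0 : ℂ) 1,
            β.generatingFunction z = Complex.exp (z / (β 1 : ℂ) ^ 2)) ∨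
        (2 * β 1 ^ 4 / β 2 ^ 2 ≠ 1 ∧
          ∃ l : ℝ, l = 1 / β 1 ^ 2 * (2 * β 1 ^ 4 / β 2 ^ 2 - 1) ∧ 0 < l ∧ l ≤ 1 ∧
            ∀ z ∈ Metric.ball (0 : ℂ) 1,
              β.generatingFunction z =
                (1 - (l : ℂ) * z) ^ (-(1 / ((l : ℂ) * (β 1 : ℂ) ^ 2))))) ∧
      ∃ c a₁ : ℝ, ψ 0 = (c : ℂ) ∧ deriv φ 0 = (a₁ : ℂ) ∧
        ∀ z ∈ Metric.ball (0 : ℂ) 1,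
          ψ z = (c : ℂ) * β.generatingFunction (starRingEnd ℂ (φ 0) * z) ∧
          φ z = φ 0 + (a₁ : ℂ) * (β 1 : ℂ) ^ 2 * z *
            (deriv β.generatingFunction (starRingEnd ℂ (φ 0) * z) /
              β.generatingFunction (starRingEnd ℂ (φ 0) * z))] := by
  tfae_have 1 → 2 := by
    rintro ⟨W, hW, hsa⟩
    have h := ContinuousLinearMap.isSelfAdjoint_iff'.1 hsa
    exact ⟨W, hW, by rw [h], by rw [h], by rw [h]⟩
  tfae_have 2 → 3 := by
    rintro ⟨W, hW, h0, h1, h2⟩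
    obtain ⟨c, hc, hc0, hψc⟩ := weight_eq_of_coeff_zero hψ_ne fun w hw => hW.mul_pow_eq hφ_self h0 hw
    obtain ⟨a, ha, hφa⟩ := symbol_eq_of_coeff_one hφ hφ_self hψ hc hψc
      fun w hw => hW.mul_pow_eq hφ_self h1 hw
    have hforms := WeightSequence.generatingFunction_forms
      (quadratic_ode_of_coeff_two hφ hφ_self hφ_zero hφ_deriv hψ hc ha hψc hφa
        fun w hw => hW.mul_pow_eq hφ_self h2 hw)
    obtain ⟨l, hl⟩ := WeightSequence.exists_isAdmissible hforms
    refine ⟨hforms, c, a, hc0, ha, fun z hz => ⟨hψc z hz, ?_⟩⟩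
    -- Dividing by `k` is legitimate only now: that `k` has no zeros in the disc is read off its
    -- closed form.
    have hne := hl.ne_zero _ (conj_mul_mem_ball (hφ_self (Metric.mem_ball_self one_pos)) hz)
    have h := hφa z hz
    refine mul_left_cancel₀ hne ?_
    rw [h, mul_add, mul_div_assoc', mul_div_cancel₀ _ hne]
    ring
  tfae_have 3 → 1 := by
    rintro ⟨hforms, c, a, _, _, h⟩
    obtain ⟨l, hl⟩ := WeightSequence.exists_isAdmissible hforms
    exact hl.exists_isWeightedComposition hφ hφ_self (fun z hz => (h z hz).1)
      (fun z hz => (h z hz).2)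
  tfae_finish
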